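/- Let $d,m\in\mathbb N$ and let $V=(v_{ij}):\mathbb R^d\to\mathbb R^{m\times m}$ be such that $v_{ij}=v_{ji}\in L^1_{\rm loc}(\mathbb R^d)$ for all $i,j$, and, for almost every $x\in\mathbb R^d$, $v_{ij}(x)\le 0$ for all $i\neq j$ and $\langle V(x)\xi,\xi\rangle\ge 0$ for all $\xi\in\mathbb R^m$. Let $\lambda_V(x)=\min_{\|u\|=1}\langle V(x)u,u\rangle$ and $\Lambda_V(x)$ denote the minimal and the maximal eigenvalue of $V(x)$, and assume that there is a constant $C\ge 1$ such that $$\lambda_V(x)\le \Lambda_V(x)\le C\,\lambda_V(x)\qquad\text{for almost every }x\in\mathbb R^d .$$ For $p\in[1,\infty]$ let $T_p$ be the operator in $L^p(\mathbb R^d,\mathbb R^m)$ defined by $$D(T_p)=\{f\in L^p(\mathbb R^d,\mathbb R^m): Vf\in L^1_{\rm loc}(\mathbb R^d,\mathbb R^m),\ (\Delta-V)f\in L^p(\mathbb R^d,\mathbb R^m)\},\qquad T_pf=(-\Delta+V)f,$$ where $\Delta f$ is understood in the sense of distributions. Then, for every $p\in[1,\infty]$, the operator $-T_p$ is $m$-dissipative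 on $L^p(\mathbb R^d,\mathbb R^m)$; that is, for every $\mu>0$, $$\mu\|u\|_p\le\|\mu u+T_pu\|_p\quad\text{for all }u\in D(T_p),$$ and $\mu+T_p:D(T_p)\to L^p(\mathbb R^d,\mathbb R^m)$ is surjective. -/

import Mathlib

open MeasureTheory
open scoped ENNReal ContDiff Laplacian InnerProductSpace

namespace KatoSchrodinger

/-- The Euclidean space `ℝⁿ`, with the Euclidean norm and inner product. -/
abbrev Rn (n : ℕ) : Type := EuclideanSpace ℝ (Fin n)

/-- The Lebesgue space `L^p(ℝ^d, ℝ^m)` for the Lebesgue measure on `ℝ^d` and the Euclidean norm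
on `ℝ^m`. -/
abbrev LpSpace (d m : ℕ) (p : ℝ≥0∞) : Type := Lp (Rn m) p (volume : Measure (Rn d))

/-- The pointwise product `x ↦ V(x) f(x)` of a matrix function and a vector function. -/
noncomputable def mulField {d m : ℕ} (V : Rn d → Matrix (Fin m) (Fin m) ℝ)
    (f : Rn d → Rn m) : Rn d → Rn m :=
  fun x => (V x).toEuclideanLin (f x)

/-- The minimal eigenvalue of a symmetric matrix: the minimum of `⟨A u, u⟩` over the unit sphere. -/
noncomputable def minEig {m : ℕ} (A : Matrix (Fin m) (Fin m) ℝ) : ℝ :=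
  sInf {r : ℝ | ∃ u : Rn m, ‖u‖ = 1 ∧ r = ⟪A.toEuclideanLin u, u⟫_ℝ}

/-- The maximal eigenvalue of a symmetric matrix. -/
noncomputable def maxEig {m : ℕ} (A : Matrix (Fin m) (Fin m) ℝ) : ℝ :=
  sSup {r : ℝ | Module.End.HasEigenvalue A.toEuclideanLin r}

/-- `V` is a matrix potential with locally integrable entries such that, for almost every `x`,
`V(x)` is symmetric and nonnegative definite, with nonpositive off-diagonal entries. -/
structure IsPotential {d m : ℕ} (V : Rn d → Matrix (Fin m) (Fin m) ℝ) : Prop where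
  locallyIntegrable : ∀ i j, LocallyIntegrable (fun x => V x i j) volume
  symm : ∀ᵐ x, ∀ i j, V x i j = V x j i
  offDiag_nonpos : ∀ᵐ x, ∀ i j, i ≠ j → V x i j ≤ 0
  form_nonneg : ∀ᵐ x, ∀ ξ : Rn m, 0 ≤ ⟪(V x).toEuclideanLin ξ, ξ⟫_ℝ

/-- The eigenvalues of `V` are comparable with each other, uniformly almost everywhere. -/
def HasComparableEigenvalues {d m : ℕ} (V : Rn d → Matrix (Fin m) (Fin m) ℝ) : Prop :=
  ∃ C : ℝ, 1 ≤ C ∧ ∀ᵐ x, minEig (V x) ≤ maxEig (V x) ∧ maxEig (V x) ≤ C * minEig (V x)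

/-- `(-Δ + V) f = g` in the sense of distributions on `ℝ^d` (componentwise in `ℝ^m`).
It is used for locally integrable `f`, `V f` and `g`. -/
def IsDistribImage {d m : ℕ} (V : Rn d → Matrix (Fin m) (Fin m) ℝ) (f g : Rn d → Rn m) : Prop :=
  ∀ φ : Rn d → ℝ, ContDiff ℝ ∞ φ → HasCompactSupport φ →
    -(∫ x, (Δ φ) x • f x) + ∫ x, φ x • mulField V f x = ∫ x, φ x • g x

/-- `f` lies in the Kato maximal domain of `-Δ + V` in `L^p` and `(-Δ + V) f = g ∈ L^p`. -/
def IsKatoPair {d m : ℕ} (V : Rn d → Matrix (Fin m) (Fin m) ℝ) (p : ℝ≥0∞)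
    (f g : LpSpace d m p) : Prop :=
  LocallyIntegrable (mulField V f) volume ∧ IsDistribImage V f g

section Helpers

variable {d m : ℕ} {V : Rn d → Matrix (Fin m) (Fin m) ℝ} {p : ℝ≥0∞}

lemma locallyIntegrable_Lp [hp : Fact (1 ≤ p)] (f : LpSpace d m p) :
    LocallyIntegrable (f : Rn d → Rn m) volume :=
  (Lp.memLp f).locallyIntegrable hp.out

lemma integrable_test_smul {φ : Rn d → ℝ} (hφ : Continuous φ) (hc : HasCompactSupport φ)
    {f : Rn d → Rn m} (hf : LocallyIntegrable f volume) :
    Integrable (fun x => φ x • f x) volume :=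
  hf.integrable_smul_left_of_hasCompactSupport hφ hc

lemma laplacian_test {φ : Rn d → ℝ} (hφ : ContDiff ℝ ∞ φ) (hc : HasCompactSupport φ) :
    Continuous (Δ φ) ∧ HasCompactSupport (Δ φ) := by
  have e : (Δ φ) = fun x => ∑ i, iteratedFDeriv ℝ 2 φ x
      ![stdOrthonormalBasis ℝ (Rn d) i, stdOrthonormalBasis ℝ (Rn d) i] :=
    InnerProductSpace.laplacian_eq_iteratedFDeriv_stdOrthonormalBasis φ
  have h2 : Continuous (iteratedFDeriv ℝ 2 φ) :=
    hφ.continuous_iteratedFDeriv (WithTop.coe_le_coe.2 (le_top : (2 : ℕ∞) ≤ ⊤))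
  constructor
  · rw [e]
    fun_prop
  · rw [e]
    refine (hc.iteratedFDeriv (𝕜 := ℝ) 2).mono fun x hx => ?_
    contrapose! hx
    have h0 : iteratedFDeriv ℝ 2 φ x = 0 := by simpa using hx
    simp [h0]

lemma IsKatoPair.unique [Fact (1 ≤ p)] {f g g' : LpSpace d m p} (h : IsKatoPair V p f g)
    (h' : IsKatoPair V p f g') : g = g' := by
  apply Lp.ext
  have hg := locallyIntegrable_Lp g
  have hg' := locallyIntegrable_Lp g'
  exact ae_eq_of_integral_contDiff_smul_eq hg hg' fun φ h1 h2 => by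
    rw [← h.2 φ h1 h2, ← h'.2 φ h1 h2]

lemma mulField_ae_congr {f g : Rn d → Rn m} (h : f =ᵐ[volume] g) :
    mulField V f =ᵐ[volume] mulField V g := by
  filter_upwards [h] with x hx
  simp [mulField, hx]

lemma IsKatoPair.add [Fact (1 ≤ p)] {f g f' g' : LpSpace d m p} (h : IsKatoPair V p f g)
    (h' : IsKatoPair V p f' g') : IsKatoPair V p (f + f') (g + g') := by
  have e : mulField V (f + f' : LpSpace d m p) =ᵐ[volume] mulField V f + mulField V f' := by
    filter_upwards [Lp.coeFn_add f f'] with x hx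
    simp only [mulField, hx, Pi.add_apply, map_add]
  refine ⟨(h.1.add h'.1).congr e.symm, fun φ h1 h2 => ?_⟩
  obtain ⟨l1, l2⟩ := laplacian_test h1 h2
  have a1 : ∫ x, (Δ φ) x • (f + f' : LpSpace d m p) x
      = (∫ x, (Δ φ) x • f x) + ∫ x, (Δ φ) x • f' x := by
    rw [← integral_add (integrable_test_smul l1 l2 (locallyIntegrable_Lp f))
      (integrable_test_smul l1 l2 (locallyIntegrable_Lp f'))]
    refine integral_congr_ae ?_
    filter_upwards [Lp.coeFn_add f f'] with x hx
    simp only [hx, Pi.add_apply, smul_add]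
  have a2 : ∫ x, φ x • mulField V (f + f' : LpSpace d m p) x
      = (∫ x, φ x • mulField V f x) + ∫ x, φ x • mulField V f' x := by
    rw [← integral_add (integrable_test_smul h1.continuous h2 h.1)
      (integrable_test_smul h1.continuous h2 h'.1)]
    refine integral_congr_ae ?_
    filter_upwards [e] with x hx
    simp only [hx, Pi.add_apply, smul_add]
  have a3 : ∫ x, φ x • (g + g' : LpSpace d m p) x
      = (∫ x, φ x • g x) + ∫ x, φ x • g' x := by
    rw [← integral_add (integrable_test_smul h1.continuous h2 (locallyIntegrable_Lp g))
      (integrable_test_smul h1.continuous h2 (locallyIntegrable_Lp g'))]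
    refine integral_congr_ae ?_
    filter_upwards [Lp.coeFn_add g g'] with x hx
    simp only [hx, Pi.add_apply, smul_add]
  rw [a1, a2, a3, ← h.2 φ h1 h2, ← h'.2 φ h1 h2]
  abel

lemma IsKatoPair.smul {f g : LpSpace d m p} (c : ℝ) (h : IsKatoPair V p f g) :
    IsKatoPair V p (c • f) (c • g) := by
  have e : mulField V (c • f : LpSpace d m p) =ᵐ[volume] c • mulField V f := by
    filter_upwards [Lp.coeFn_smul c f] with x hx
    simp only [mulField, hx, Pi.smul_apply, map_smul]
  refine ⟨(h.1.smul c).congr e.symm, fun φ h1 h2 => ?_⟩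
  have a1 : ∫ x, (Δ φ) x • (c • f : LpSpace d m p) x = c • ∫ x, (Δ φ) x • f x := by
    rw [← integral_smul]
    refine integral_congr_ae ?_
    filter_upwards [Lp.coeFn_smul c f] with x hx
    simp only [hx, Pi.smul_apply, smul_comm c]
  have a2 : ∫ x, φ x • mulField V (c • f : LpSpace d m p) x
      = c • ∫ x, φ x • mulField V f x := by
    rw [← integral_smul]
    refine integral_congr_ae ?_
    filter_upwards [e] with x hx
    simp only [hx, Pi.smul_apply, smul_comm c]
  have a3 : ∫ x, φ x • (c • g : LpSpace d m p) x = c • ∫ x, φ x • g x := by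
    rw [← integral_smul]
    refine integral_congr_ae ?_
    filter_upwards [Lp.coeFn_smul c g] with x hx
    simp only [hx, Pi.smul_apply, smul_comm c]
  rw [a1, a2, a3, ← h.2 φ h1 h2, smul_add, smul_neg]

lemma IsKatoPair.zero : IsKatoPair V p (0 : LpSpace d m p) 0 := by
  have e : mulField V (0 : LpSpace d m p) =ᵐ[volume] 0 := by
    filter_upwards [Lp.coeFn_zero (Rn m) p (volume : Measure (Rn d))] with x hx
    simp only [mulField, hx, Pi.zero_apply, map_zero]
  have z : ∀ ψ : Rn d → ℝ, ∫ x, ψ x • (0 : LpSpace d m p) x = 0 := fun ψ => by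
    refine integral_eq_zero_of_ae ?_
    filter_upwards [Lp.coeFn_zero (Rn m) p (volume : Measure (Rn d))] with x hx
    simp only [hx, Pi.zero_apply, smul_zero]
  refine ⟨locallyIntegrable_zero.congr e.symm, fun φ _ _ => ?_⟩
  have a2 : ∫ x, φ x • mulField V (0 : LpSpace d m p) x = 0 := by
    refine integral_eq_zero_of_ae ?_
    filter_upwards [e] with x hx
    simp only [hx, Pi.zero_apply, smul_zero]
  rw [z, z, a2]
  simp

end Helpers

/-- The Kato maximal domain
`D(T_p) = {f ∈ L^p : V f ∈ L^1_loc and (-Δ + V) f ∈ L^p}`, the last condition being understood in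
the sense of distributions. -/
def katoDomain {d m : ℕ} (V : Rn d → Matrix (Fin m) (Fin m) ℝ) (p : ℝ≥0∞) [Fact (1 ≤ p)] :
    Submodule ℝ (LpSpace d m p) where
  carrier := {f | LocallyIntegrable (mulField V f) volume ∧
    ∃ g : LpSpace d m p, IsDistribImage V f g}
  add_mem' := by
    rintro f f' ⟨h, g, hg⟩ ⟨h', g', hg'⟩
    have := IsKatoPair.add (V := V) ⟨h, hg⟩ ⟨h', hg'⟩
    exact ⟨this.1, _, this.2⟩
  zero_mem' := ⟨IsKatoPair.zero.1, _, IsKatoPair.zero.2⟩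
  smul_mem' := by
    rintro c f ⟨h, g, hg⟩
    have := IsKatoPair.smul (V := V) c ⟨h, hg⟩
    exact ⟨this.1, _, this.2⟩

/-- The operator `T_p`: the realization of `-Δ + V` in `L^p(ℝ^d, ℝ^m)` with Kato maximal domain. -/
noncomputable def katoOp {d m : ℕ} (V : Rn d → Matrix (Fin m) (Fin m) ℝ) (p : ℝ≥0∞)
    [Fact (1 ≤ p)] : LpSpace d m p →ₗ.[ℝ] LpSpace d m p where
  domain := katoDomain V p
  toFun :=
    { toFun := fun f => f.2.2.choose
      map_add' := fun f f' =>
        IsKatoPair.unique (V := V) ⟨(f + f').2.1, (f + f').2.2.choose_spec⟩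
          (IsKatoPair.add ⟨f.2.1, f.2.2.choose_spec⟩ ⟨f'.2.1, f'.2.2.choose_spec⟩)
      map_smul' := fun c f =>
        IsKatoPair.unique (V := V) ⟨(c • f).2.1, (c • f).2.2.choose_spec⟩
          (IsKatoPair.smul c ⟨f.2.1, f.2.2.choose_spec⟩) }

/-- The graph of `T_p`: `T_p f = g` iff `V f ∈ L^1_loc` and `(-Δ + V) f = g` in the sense of
distributions. -/
theorem mem_graph_katoOp {d m : ℕ} (V : Rn d → Matrix (Fin m) (Fin m) ℝ) (p : ℝ≥0∞)
    [Fact (1 ≤ p)] (f g : LpSpace d m p) :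
    (f, g) ∈ (katoOp V p).graph ↔ IsKatoPair V p f g := by
  rw [LinearPMap.mem_graph_iff]
  constructor
  · rintro ⟨y, rfl, rfl⟩
    exact ⟨y.2.1, y.2.2.choose_spec⟩
  · intro h
    let y : (katoOp V p).domain := ⟨f, h.1, g, h.2⟩
    exact ⟨y, rfl, IsKatoPair.unique (V := V) ⟨y.2.1, y.2.2.choose_spec⟩ h⟩

/-- A linear operator `A : D(A) ⊆ X → X` is dissipative if `μ ‖u‖ ≤ ‖μ u - A u‖` for all `μ > 0`
and `u ∈ D(A)`. -/
def IsDissipative {X : Type*} [NormedAddCommGroup X] [NormedSpace ℝ X] (A : X →ₗ.[ℝ] X) : Prop :=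
  ∀ μ : ℝ, 0 < μ → ∀ u : A.domain, μ * ‖(u : X)‖ ≤ ‖μ • (u : X) - A u‖

/-- `A` is m-dissipative if it is dissipative and `μ - A : D(A) → X` is onto for all `μ > 0`;
equivalently, every `μ > 0` is in the resolvent set of `A` and `‖(μ - A)⁻¹‖ ≤ 1 / μ`. -/
def IsMDissipative {X : Type*} [NormedAddCommGroup X] [NormedSpace ℝ X] (A : X →ₗ.[ℝ] X) : Prop :=
  IsDissipative A ∧ ∀ μ : ℝ, 0 < μ → ∀ f : X, ∃ u : A.domain, μ • (u : X) - A u = f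

end KatoSchrodinger

/-!
The equation `(a - Δ + V) u = f` is controlled by the free equation `(a - Δ) z = |f|`.

The free resolvent `(a - Δ)⁻¹` is convolution with the finite positive measure
`∫₀^∞ e^{-a t} N(0, 2 t) dt` of mass `1 / a` (`resolventMeasure`). Its characteristic function is
`1 / (a + |ξ|²)`, so that it is a fundamental solution of `a - Δ` (`integral_resolventMeasure`).
Being an average of translations, it has norm at most `1 / a` on every `L^p`.

*Dissipativity.* Kato's inequality `Δ|u| ≥ ⟨Δu, u⟩ / |u|` (`kato_inequality`) holds for smooth `u`
and the regularized norm `√(|u|² + δ²)` because the latter is convex, and in general by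
mollification and `δ → 0`. As the form of `V` is nonnegative, it makes `|u|` a subsolution of
`(a - Δ) z = |f|`. The comparison principle in `L^p` (`ae_nonpos_of_subsolution`) is the maximum
principle for the bounded smooth functions obtained by mollification, and gives
`|u| ≤ (a - Δ)⁻¹ |f|` (`IsSolution.norm_le_resolvent`). This is stronger than dissipativity, and
it works for all `p ∈ [1, ∞]` at once.

*Existence.* For bounded `V` and `f ∈ L¹` the solution is the fixed point of the contraction
`u ↦ (a + M - Δ)⁻¹ (f + (M - V) u)` of `L¹`, where `0 ≤ V ≤ M`. For locally integrable `V` and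
`f ∈ L¹ ∩ L^∞`, `V` is replaced by bounded multiples of itself. The solutions are dominated by a
bounded integrable function, and testing Kato's inequality for their differences with cutoff
functions shows that they converge in `L¹`. For general `f ∈ L^p`, `f` is replaced by truncations
`f_k`. The solutions `u_k` then converge almost everywhere, by domination of their differences by
`(a - Δ)⁻¹ |f - f_k|`, and only the convergence of `V u_k` in `L¹_loc` remains. Kato's inequality
bounds `⟨V u, u⟩ / |u|` in `L¹_loc`, and comparability of the eigenvalues gives
`|V u| ≤ C ⟨V u, u⟩ / |u|` (`norm_mul_norm_le_of_comparable`), which settles it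
(`IsSolution.lintegral_mulField_le`).
-/

namespace KatoSchrodinger

open Filter Topology

variable {d m : ℕ}

/-! ### Test functions and the Laplacian -/

/-- Smooth compactly supported real functions on `ℝᵈ`. -/
structure IsTest (φ : Rn d → ℝ) : Prop where
  smooth : ContDiff ℝ ∞ φ
  compact : HasCompactSupport φ

lemma IsTest.continuous {φ : Rn d → ℝ} (h : IsTest φ) : Continuous φ := h.smooth.continuous

lemma IsTest.continuous_laplacian {φ : Rn d → ℝ} (h : IsTest φ) : Continuous (Δ φ) :=
  (laplacian_test h.smooth h.compact).1

lemma IsTest.compact_laplacian {φ : Rn d → ℝ} (h : IsTest φ) : HasCompactSupport (Δ φ) :=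
  (laplacian_test h.smooth h.compact).2

lemma IsTest.continuous_resolventOp {φ : Rn d → ℝ} (h : IsTest φ) (a : ℝ) :
    Continuous fun x => a * φ x - (Δ φ) x :=
  (continuous_const.mul h.continuous).sub h.continuous_laplacian

lemma IsTest.compact_resolventOp {φ : Rn d → ℝ} (h : IsTest φ) (a : ℝ) :
    HasCompactSupport fun x => a * φ x - (Δ φ) x :=
  (h.compact.mul_left (f := fun _ => a)).sub h.compact_laplacian

lemma IsTest.contDiff_two {φ : Rn d → ℝ} (h : IsTest φ) : ContDiff ℝ 2 φ :=
  h.smooth.of_le (WithTop.coe_le_coe.2 le_top)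

section Laplacian

variable {F : Type*} [NormedAddCommGroup F] [NormedSpace ℝ F]

lemma laplacian_eq_sum_fderiv {f : Rn d → F} (hf : ContDiff ℝ 2 f) (x : Rn d) :
    (Δ f) x = ∑ i, fderiv ℝ (fun y => fderiv ℝ f y (EuclideanSpace.basisFun (Fin d) ℝ i)) x
      (EuclideanSpace.basisFun (Fin d) ℝ i) := by
  rw [InnerProductSpace.laplacian_eq_iteratedFDeriv_orthonormalBasis f
    (EuclideanSpace.basisFun (Fin d) ℝ)]
  refine Finset.sum_congr rfl fun i _ => ?_
  have h1 : DifferentiableAt ℝ (fderiv ℝ f) x :=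
    (hf.fderiv_right (m := 1) (by norm_num)).differentiable (by norm_num) x
  rw [iteratedFDeriv_two_apply, fderiv_clm_apply h1 (by fun_prop)]
  simp

lemma continuous_laplacian {f : Rn d → F} (hf : ContDiff ℝ 2 f) : Continuous (Δ f) := by
  have h2 : Continuous (iteratedFDeriv ℝ 2 f) := hf.continuous_iteratedFDeriv le_rfl
  rw [InnerProductSpace.laplacian_eq_iteratedFDeriv_orthonormalBasis f
    (EuclideanSpace.basisFun (Fin d) ℝ)]
  fun_prop

lemma hasDerivAt_comp_line {f : Rn d → F} (hf : ContDiff ℝ 2 f) (x e : Rn d) (t : ℝ) :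
    HasDerivAt (fun s : ℝ => f (x + s • e)) (fderiv ℝ f (x + t • e) e) t := by
  have h1 : HasFDerivAt f (fderiv ℝ f (x + t • e)) (x + t • e) :=
    (hf.differentiable (by norm_num) _).hasFDerivAt
  have h2 : HasDerivAt (fun s : ℝ => x + s • e) e t := by
    simpa using ((hasDerivAt_id t).smul_const e).const_add x
  exact h1.comp_hasDerivAt t h2

/-- A one-variable function has nonnegative second derivative at a local minimum. -/
lemma deriv_deriv_nonneg_of_isLocalMin {g : ℝ → ℝ} {t : ℝ} (h : IsLocalMin g t)
    (hc : ContinuousAt g t) : 0 ≤ deriv (deriv g) t := by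
  by_contra! hn
  have hmax := isLocalMax_of_deriv_deriv_neg hn h.deriv_eq_zero hc
  have he : g =ᶠ[𝓝 t] fun _ => g t := by
    filter_upwards [h, hmax] with s h1 h2 using le_antisymm h2 h1
  have h2 : deriv g =ᶠ[𝓝 t] fun _ => 0 := by
    have := he.deriv
    simpa using this
  rw [h2.deriv_eq] at hn
  simp at hn

/-- The source of both the maximum principle and the convexity inequality behind Kato's
inequality. -/
lemma laplacian_nonneg_of_isLocalMin {f : Rn d → ℝ} (hf : ContDiff ℝ 2 f) {x : Rn d}
    (h : IsLocalMin f x) : 0 ≤ (Δ f) x := by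
  rw [laplacian_eq_sum_fderiv hf]
  refine Finset.sum_nonneg fun i _ => ?_
  set e := EuclideanSpace.basisFun (Fin d) ℝ i
  set g : ℝ → ℝ := fun s => f (x + s • e)
  have hg : deriv g = fun s => fderiv ℝ f (x + s • e) e := by
    ext s; exact (hasDerivAt_comp_line hf x e s).deriv
  have hf1 : ContDiff ℝ 1 (fun y => fderiv ℝ f y e) :=
    (hf.fderiv_right (m := 1) (by norm_num)).clm_apply contDiff_const
  have h2 : deriv (deriv g) 0 = fderiv ℝ (fun y => fderiv ℝ f y e) x e := by
    rw [hg]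
    have h1 : HasFDerivAt (fun y => fderiv ℝ f y e)
        (fderiv ℝ (fun y => fderiv ℝ f y e) (x + (0:ℝ) • e)) (x + (0:ℝ) • e) :=
      (hf1.differentiable (by norm_num) _).hasFDerivAt
    have h3 : HasDerivAt (fun s : ℝ => x + s • e) e 0 := by
      simpa using ((hasDerivAt_id (0:ℝ)).smul_const e).const_add x
    have := (h1.comp_hasDerivAt 0 h3).deriv
    simpa [Function.comp_def] using this
  rw [← h2]
  have hcont : Continuous (fun s : ℝ => x + s • e) := by fun_prop
  apply deriv_deriv_nonneg_of_isLocalMin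
  · have h0 : Tendsto (fun s : ℝ => x + s • e) (𝓝 0) (𝓝 x) := by
      simpa using hcont.tendsto 0
    have := h0.eventually h
    simpa [IsLocalMin, IsMinFilter, g] using this
  · exact (hf.continuous.comp hcont).continuousAt

lemma laplacian_norm_sq (x : Rn d) : (Δ (fun y : Rn d => ‖y‖ ^ 2)) x = (2 * d : ℝ) := by
  rw [laplacian_eq_sum_fderiv (contDiff_norm_sq ℝ)]
  have h : ∀ e : Rn d, (fun y : Rn d => fderiv ℝ (fun y : Rn d => ‖y‖ ^ 2) y e)
      = fun y => (2 • (innerSL ℝ e)) y := by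
    intro e; ext y
    simp [real_inner_comm]
  simp only [h, ContinuousLinearMap.fderiv]
  simp
  ring

lemma fderiv_comp_affine {f : Rn d → F} {c : ℝ} {a t : Rn d}
    (hf : DifferentiableAt ℝ f (c • t + a)) (e : Rn d) :
    fderiv ℝ (fun y => f (c • y + a)) t e = c • fderiv ℝ f (c • t + a) e := by
  have h1 : HasFDerivAt (fun y : Rn d => c • y + a) (c • ContinuousLinearMap.id ℝ (Rn d)) t :=
    ((hasFDerivAt_id t).const_smul c).add_const a
  have h2 := (hf.hasFDerivAt.comp t h1).fderiv
  simp only [Function.comp_def] at h2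
  rw [h2]
  simp

lemma laplacian_comp_affine {f : Rn d → F} (hf : ContDiff ℝ 2 f) (c : ℝ) (a t : Rn d) :
    (Δ (fun y => f (c • y + a))) t = c ^ 2 • (Δ f) (c • t + a) := by
  have h1 : ContDiff ℝ 2 fun y => f (c • y + a) := hf.comp (by fun_prop)
  rw [laplacian_eq_sum_fderiv h1, laplacian_eq_sum_fderiv hf, Finset.smul_sum]
  refine Finset.sum_congr rfl fun i _ => ?_
  set e := EuclideanSpace.basisFun (Fin d) ℝ i
  have hf1 : Differentiable ℝ (fun y => fderiv ℝ f y e) :=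
    ((hf.fderiv_right (m := 1) (by norm_num)).clm_apply contDiff_const).differentiable
      (by norm_num)
  have h : (fun y => fderiv ℝ (fun y => f (c • y + a)) y e)
      = fun y => c • (fun z => fderiv ℝ f z e) (c • y + a) := by
    ext y
    rw [fderiv_comp_affine (hf.differentiable (by norm_num) _)]
  have h2 : DifferentiableAt ℝ (fun y => (fun z => fderiv ℝ f z e) (c • y + a)) t :=
    (hf1 _).comp t (by fun_prop)
  rw [h, fderiv_fun_const_smul h2, smul_apply,
    fderiv_comp_affine (f := fun z => fderiv ℝ f z e) (hf1 _), smul_smul, pow_two]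

lemma laplacian_comp_sub_left {f : Rn d → F} (hf : ContDiff ℝ 2 f) (x t : Rn d) :
    (Δ (fun y => f (x - y))) t = (Δ f) (x - t) := by
  simpa [neg_add_eq_sub] using laplacian_comp_affine hf (-1) x t

/-- Integration by parts against a test function: the Laplacian is symmetric. -/
lemma integral_mul_laplacian {f φ : Rn d → ℝ} (hf : ContDiff ℝ 2 f) (hφ : IsTest φ) :
    ∫ x, f x * (Δ φ) x = ∫ x, (Δ f) x * φ x := by
  have hφ2 : ContDiff ℝ 2 φ := hφ.smooth.of_le (WithTop.coe_le_coe.2 le_top)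
  have hφ1 : ∀ e : Rn d, ContDiff ℝ 1 (fun y => fderiv ℝ φ y e) := fun e =>
    (hφ2.fderiv_right (m := 1) (by norm_num)).clm_apply contDiff_const
  have hf1 : ∀ e : Rn d, ContDiff ℝ 1 (fun y => fderiv ℝ f y e) := fun e =>
    (hf.fderiv_right (m := 1) (by norm_num)).clm_apply contDiff_const
  have c1 : ∀ e : Rn d, HasCompactSupport (fun y => fderiv ℝ φ y e) := fun e =>
    hφ.compact.fderiv_apply ℝ e
  have c2 : ∀ e : Rn d, HasCompactSupport (fun x => fderiv ℝ (fun y => fderiv ℝ φ y e) x e) :=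
    fun e => (c1 e).fderiv_apply ℝ e
  have k1 : ∀ e : Rn d, Continuous (fun x => fderiv ℝ (fun y => fderiv ℝ φ y e) x e) :=
    fun e => ((hφ1 e).fderiv_right (m := 0) (by norm_num)).continuous.clm_apply continuous_const
  have k2 : ∀ e : Rn d, Continuous (fun x => fderiv ℝ (fun y => fderiv ℝ f y e) x e) :=
    fun e => ((hf1 e).fderiv_right (m := 0) (by norm_num)).continuous.clm_apply continuous_const
  have i1 : ∀ e : Rn d, Integrable fun x => f x * fderiv ℝ (fun y => fderiv ℝ φ y e) x e :=
    fun e => (hf.continuous.mul (k1 e)).integrable_of_hasCompactSupport (c2 e).mul_left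
  have i2 : ∀ e : Rn d, Integrable fun x => fderiv ℝ (fun y => fderiv ℝ f y e) x e * φ x :=
    fun e => ((k2 e).mul hφ.continuous).integrable_of_hasCompactSupport hφ.compact.mul_left
  have i3 : ∀ e : Rn d, Integrable fun x => fderiv ℝ f x e * fderiv ℝ φ x e :=
    fun e => ((hf1 e).continuous.mul (hφ1 e).continuous).integrable_of_hasCompactSupport
      (c1 e).mul_left
  have i4 : ∀ e : Rn d, Integrable fun x => f x * fderiv ℝ φ x e :=
    fun e => (hf.continuous.mul (hφ1 e).continuous).integrable_of_hasCompactSupport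
      (c1 e).mul_left
  have i5 : ∀ e : Rn d, Integrable fun x => fderiv ℝ f x e * φ x :=
    fun e => ((hf1 e).continuous.mul hφ.continuous).integrable_of_hasCompactSupport
      hφ.compact.mul_left
  simp only [laplacian_eq_sum_fderiv hf, laplacian_eq_sum_fderiv hφ2, Finset.mul_sum,
    Finset.sum_mul]
  rw [integral_finsetSum _ fun i _ => i1 _, integral_finsetSum _ fun i _ => i2 _]
  refine Finset.sum_congr rfl fun i _ => ?_
  set e := EuclideanSpace.basisFun (Fin d) ℝ i
  rw [integral_mul_fderiv_eq_neg_fderiv_mul_of_integrable (i3 e) (i1 e) (i4 e)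
      (fun x _ => hf.differentiable (by norm_num) x)
      (fun x _ => (hφ1 e).differentiable (by norm_num) x),
    integral_mul_fderiv_eq_neg_fderiv_mul_of_integrable (f := fun x => fderiv ℝ f x e)
      (i2 e) (i3 e) (i5 e)
      (fun x _ => (hf1 e).differentiable (by norm_num) x)
      (fun x _ => hφ2.differentiable (by norm_num) x), neg_neg]

end Laplacian

/-! ### Mollification -/

section Mollification

open ContinuousLinearMap

variable {F : Type*} [NormedAddCommGroup F] [NormedSpace ℝ F]

lemma hasCompactSupport_comp_sub_left {α : Type*} [Zero α] {ρ : Rn d → α}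
    (hc : HasCompactSupport ρ) (x : Rn d) : HasCompactSupport fun t => ρ (x - t) :=
  hc.comp_homeomorph (Homeomorph.subLeft x)

lemma integrable_mollify {ρ : Rn d → ℝ} (hρ : Continuous ρ) (hc : HasCompactSupport ρ)
    {z : Rn d → F} (hz : LocallyIntegrable z) (x : Rn d) :
    Integrable fun t => ρ (x - t) • z t :=
  hz.integrable_smul_left_of_hasCompactSupport (hρ.comp (by fun_prop))
    (hasCompactSupport_comp_sub_left hc x)

lemma mollify_contDiff {ρ : Rn d → ℝ} (hρ : IsTest ρ) {z : Rn d → F}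
    (hz : LocallyIntegrable z) : ContDiff ℝ ∞ (fun x => ∫ t, ρ (x - t) • z t) := by
  have := hρ.compact.contDiff_convolution_left (lsmul ℝ ℝ) hρ.smooth hz (n := ⊤)
  convert this using 2 with x
  rw [convolution_eq_swap]; rfl

lemma fderiv_mollify [CompleteSpace F] {ρ : Rn d → ℝ} (hρ : ContDiff ℝ 1 ρ)
    (hc : HasCompactSupport ρ) {z : Rn d → F} (hz : LocallyIntegrable z) (x e : Rn d) :
    fderiv ℝ (fun x => ∫ t, ρ (x - t) • z t) x e = ∫ t, fderiv ℝ ρ (x - t) e • z t := by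
  have h1 := (hc.hasFDerivAt_convolution_left (lsmul ℝ ℝ) hρ hz x).fderiv
  have h2 : (convolution ρ z (lsmul ℝ ℝ) volume) = fun x => ∫ t, ρ (x - t) • z t := by
    ext x; rw [convolution_eq_swap]; rfl
  rw [h2] at h1
  rw [h1, convolution_eq_swap]
  have hi : Integrable fun t => (precompL (Rn d) (lsmul ℝ ℝ : ℝ →L[ℝ] F →L[ℝ] F))
      (fderiv ℝ ρ (x - t)) (z t) := by
    have h3 := (hc.fderiv (𝕜 := ℝ)).convolutionExists_left
      (precompL (Rn d) (lsmul ℝ ℝ : ℝ →L[ℝ] F →L[ℝ] F)) (hρ.continuous_fderiv one_ne_zero) hz x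
    exact convolutionExistsAt_iff_integrable_swap.1 h3
  rw [ContinuousLinearMap.integral_apply hi]
  simp

/-- The Laplacian of a mollification falls on the mollifier. -/
lemma laplacian_mollify [CompleteSpace F] {ρ : Rn d → ℝ} (hρ : IsTest ρ) {z : Rn d → F}
    (hz : LocallyIntegrable z) (x : Rn d) :
    (Δ (fun x => ∫ t, ρ (x - t) • z t)) x = ∫ t, (Δ ρ) (x - t) • z t := by
  have hρ2 : ContDiff ℝ 2 ρ := hρ.smooth.of_le (WithTop.coe_le_coe.2 le_top)
  have hρ1 : ∀ e : Rn d, ContDiff ℝ 1 (fun y => fderiv ℝ ρ y e) := fun e =>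
    (hρ2.fderiv_right (m := 1) (by norm_num)).clm_apply contDiff_const
  have c1 : ∀ e : Rn d, HasCompactSupport (fun y => fderiv ℝ ρ y e) := fun e =>
    hρ.compact.fderiv_apply ℝ e
  rw [laplacian_eq_sum_fderiv ((mollify_contDiff hρ hz).of_le (WithTop.coe_le_coe.2 le_top))]
  simp only [fderiv_mollify (hρ2.of_le one_le_two) hρ.compact hz, fderiv_mollify (hρ1 _) (c1 _) hz,
    laplacian_eq_sum_fderiv hρ2, Finset.sum_smul]
  rw [integral_finsetSum]
  intro i _
  exact integrable_mollify (((hρ1 _).fderiv_right (m := 0) (by norm_num)).continuous.clm_apply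
    continuous_const) ((c1 _).fderiv_apply ℝ _) hz x

end Mollification

/-! ### The resolvent kernel of the Laplacian -/

/-- The measure `e^{-a t} dt` on the positive half-line. -/
noncomputable def expWeight (a : ℝ) : Measure ℝ :=
  (volume.restrict (Set.Ioi 0)).withDensity fun t => ENNReal.ofReal (Real.exp (-(a * t)))

lemma integral_expWeight (a : ℝ) (f : ℝ → ℂ) :
    ∫ t, f t ∂(expWeight a) = ∫ t in Set.Ioi 0, Real.exp (-(a * t)) • f t := by
  rw [expWeight, integral_withDensity_eq_integral_toReal_smul (by fun_prop) (by simp)]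
  refine integral_congr_ae (Eventually.of_forall fun t => ?_)
  simp [ENNReal.toReal_ofReal (Real.exp_pos _).le]

lemma integral_exp_neg_mul_Ioi {a : ℝ} (ha : 0 < a) :
    ∫ t in Set.Ioi 0, Real.exp (-(a * t)) = a⁻¹ := by
  have := integral_exp_mul_Ioi (a := -a) (by linarith) 0
  simpa [neg_mul] using this

lemma expWeight_univ {a : ℝ} (ha : 0 < a) : expWeight a Set.univ = ENNReal.ofReal a⁻¹ := by
  have hi : IntegrableOn (fun t => Real.exp (-(a * t))) (Set.Ioi 0) := by
    simpa [neg_mul] using exp_neg_integrableOn_Ioi 0 ha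
  rw [expWeight, withDensity_apply _ MeasurableSet.univ, Measure.restrict_univ,
    ← ofReal_integral_eq_lintegral_ofReal hi
      (Eventually.of_forall fun t => (Real.exp_pos _).le), integral_exp_neg_mul_Ioi ha]

/-- The resolvent kernel of the Laplacian: the measure `∫₀^∞ e^{-a t} N(0, 2 t) dt`, where
`N(0, 2 t)` is the centred Gaussian of covariance `2 t`. -/
noncomputable def resolventMeasure (d : ℕ) (a : ℝ) : Measure (Rn d) :=
  ((expWeight a).prod (ProbabilityTheory.stdGaussian (Rn d))).map
    fun q => Real.sqrt (2 * q.1) • q.2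

instance (a : ℝ) : SFinite (expWeight a) := by unfold expWeight; infer_instance

lemma measurable_scale : Measurable fun q : ℝ × Rn d => Real.sqrt (2 * q.1) • q.2 := by
  fun_prop

lemma resolventMeasure_univ {a : ℝ} (ha : 0 < a) :
    resolventMeasure d a Set.univ = ENNReal.ofReal a⁻¹ := by
  rw [resolventMeasure, Measure.map_apply measurable_scale MeasurableSet.univ, Set.preimage_univ,
    ← Set.univ_prod_univ, Measure.prod_prod, expWeight_univ ha]
  simp

lemma isFiniteMeasure_resolventMeasure {a : ℝ} (ha : 0 < a) :
    IsFiniteMeasure (resolventMeasure d a) :=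
  ⟨by rw [resolventMeasure_univ ha]; exact ENNReal.ofReal_lt_top⟩

/-- The characteristic function of `N(0, 2 t)` is `e^{-t |ξ|²}`, and its Laplace transform in `t`
is `1 / (a + |ξ|²)`. -/
lemma charFun_resolventMeasure {a : ℝ} (ha : 0 < a) (ξ : Rn d) :
    charFun (resolventMeasure d a) ξ = ((a + ‖ξ‖ ^ 2 : ℝ) : ℂ)⁻¹ := by
  have hf : IsFiniteMeasure (expWeight a) :=
    ⟨by rw [expWeight_univ ha]; exact ENNReal.ofReal_lt_top⟩
  rw [charFun_apply, resolventMeasure, integral_map measurable_scale.aemeasurable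
    (by fun_prop), integral_prod]
  · have h1 : ∀ t : ℝ, 0 < t → ∫ z, Complex.exp (⟪Real.sqrt (2 * t) • z, ξ⟫_ℝ * Complex.I)
        ∂(ProbabilityTheory.stdGaussian (Rn d)) = (Real.exp (-(‖ξ‖ ^ 2 * t)) : ℂ) := by
      intro t ht
      have := ProbabilityTheory.charFun_stdGaussian (Real.sqrt (2 * t) • ξ)
      rw [charFun_apply] at this
      simp only [inner_smul_left, inner_smul_right] at this ⊢
      simp only [RCLike.conj_to_real]
      rw [this, norm_smul, Complex.ofReal_exp]
      congr 1
      simp only [Real.norm_eq_abs, abs_of_nonneg (Real.sqrt_nonneg _)]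
      rw [← Complex.ofReal_pow, mul_pow, Real.sq_sqrt (by positivity)]
      push_cast
      ring
    rw [integral_expWeight, setIntegral_congr_fun (g := fun t =>
      ((Real.exp (-((a + ‖ξ‖ ^ 2) * t)) : ℝ) : ℂ)) measurableSet_Ioi]
    · rw [integral_complex_ofReal, integral_exp_neg_mul_Ioi (by positivity)]
      push_cast; rfl
    · intro t ht
      simp only
      rw [h1 t ht, Complex.real_smul, ← Complex.ofReal_mul, ← Real.exp_add]
      congr 2; ring
  · refine Integrable.of_bound (C := 1) (by fun_prop) (Eventually.of_forall fun q => ?_)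
    rw [Complex.norm_exp_ofReal_mul_I]

open FourierTransform in
/-- The Fourier transform turns `Δ` into multiplication by `-(2 π |ξ|)²`; Mathlib's Fourier
transform has the character `exp (-2 π i ⟪x, ξ⟫)`. -/
lemma fourier_laplacian_apply (f : SchwartzMap (Rn d) ℂ) (ξ : Rn d) :
    ((𝓕 (Δ f)) ξ : ℂ) = -(((2 * Real.pi * ‖ξ‖) ^ 2 : ℝ) : ℂ) * (𝓕 f) ξ := by
  rw [SchwartzMap.laplacian_eq_fourierMultiplierCLM, FourierTransform.fourier_smul,
    SchwartzMap.fourierMultiplierCLM_apply, FourierTransform.fourier_fourierInv_eq]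
  rw [smul_apply, SchwartzMap.smulLeftCLM_apply_apply (by fun_prop)]
  simp [mul_pow]
  ring

open FourierTransform in
/-- Fourier inversion, written with the characters `exp (i ⟪x, η⟫)`, `η = 2 π ξ`, that occur in
`charFun`. -/
lemma fourierInv_expansion (f : SchwartzMap (Rn d) ℂ) (x : Rn d) :
    f x = ∫ ξ, Complex.exp (⟪x, (2 * Real.pi) • ξ⟫_ℝ * Complex.I) * (𝓕 f) ξ := by
  conv_lhs => rw [← FourierTransform.fourierInv_fourier_eq (F := SchwartzMap (Rn d) ℂ) f]
  rw [SchwartzMap.fourierInv_coe, Real.fourierInv_eq']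
  refine integral_congr_ae (Eventually.of_forall fun ξ => ?_)
  simp only [smul_eq_mul]
  congr 3
  simp [inner_smul_right, real_inner_comm]

open FourierTransform in
/-- Integrating a Schwartz function against a translate of the resolvent measure. -/
lemma integral_resolventMeasure_schwartz {a : ℝ} (ha : 0 < a) (f : SchwartzMap (Rn d) ℂ)
    (x : Rn d) :
    ∫ y, f (x + y) ∂(resolventMeasure d a) =
      ∫ ξ, Complex.exp (⟪x, (2 * Real.pi) • ξ⟫_ℝ * Complex.I) *
        (((a + (2 * Real.pi * ‖ξ‖) ^ 2 : ℝ) : ℂ)⁻¹ * (𝓕 f) ξ) := by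
  have := isFiniteMeasure_resolventMeasure (d := d) ha
  simp_rw [fourierInv_expansion f]
  rw [integral_integral_swap]
  · refine integral_congr_ae (Eventually.of_forall fun ξ => ?_)
    simp only
    have h := charFun_resolventMeasure ha ((2 * Real.pi) • ξ)
    rw [norm_smul, Real.norm_eq_abs, abs_of_pos (by positivity), charFun_apply] at h
    rw [← h, ← integral_mul_const, ← integral_const_mul]
    refine integral_congr_ae (Eventually.of_forall fun y => ?_)
    simp only [inner_add_left]
    push_cast
    rw [add_mul, Complex.exp_add]; ring
  · have hi : Integrable (fun q : Rn d × Rn d => (1:ℂ) * (𝓕 f) q.2)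
        ((resolventMeasure d a).prod volume) :=
      (integrable_const (1:ℂ)).mul_prod (𝓕 f).integrable
    refine hi.mono ?_ (Eventually.of_forall fun q => ?_)
    · refine Continuous.aestronglyMeasurable ?_
      have := (𝓕 f).continuous
      simp only [Function.uncurry_def]
      fun_prop
    · simp only [Function.uncurry_def, norm_mul, Complex.norm_exp_ofReal_mul_I, norm_one, le_refl]

/-- The resolvent measure is a fundamental solution of `a - Δ`. -/
lemma integral_resolventMeasure {a : ℝ} (ha : 0 < a) {φ : Rn d → ℝ} (hφ : IsTest φ) (x : Rn d) :
    ∫ y, (a * φ (x + y) - (Δ φ) (x + y)) ∂(resolventMeasure d a) = φ x := by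
  have hc : HasCompactSupport (Complex.ofRealCLM ∘ φ) := hφ.compact.comp_left (by simp)
  let f : SchwartzMap (Rn d) ℂ := hc.toSchwartzMap (Complex.ofRealCLM.contDiff.comp hφ.smooth)
  have hf : ∀ y, f y = (φ y : ℂ) := fun y => rfl
  have hΔ : ∀ y, (Δ f) y = ((Δ φ) y : ℂ) := fun y => by
    rw [SchwartzMap.laplacian_apply]
    exact hφ.contDiff_two.contDiffAt.laplacian_CLM_comp_left
  have h := integral_resolventMeasure_schwartz ha ((a : ℂ) • f - Δ f) x
  have h1 : ∀ ξ, ((((a + (2 * Real.pi * ‖ξ‖) ^ 2 : ℝ) : ℂ)⁻¹ *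
      (FourierTransform.fourier ((a : ℂ) • f - Δ f)) ξ) : ℂ) = (FourierTransform.fourier f) ξ := by
    intro ξ
    have h0 : ((a + (2 * Real.pi * ‖ξ‖) ^ 2 : ℝ) : ℂ) ≠ 0 := by
      rw [Complex.ofReal_ne_zero]; positivity
    rw [sub_eq_add_neg, ← neg_one_smul ℂ (Δ f), FourierTransform.fourier_add,
      FourierTransform.fourier_smul, FourierTransform.fourier_smul, add_apply, smul_apply,
      smul_apply, fourier_laplacian_apply, smul_eq_mul, inv_mul_eq_iff_eq_mul₀ h0]
    push_cast
    simp only [smul_eq_mul]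
    ring
  simp only [h1] at h
  rw [← fourierInv_expansion f x, hf] at h
  have h2 : ∀ y, ((a : ℂ) • f - Δ f) (x + y) = ((a * φ (x + y) - (Δ φ) (x + y) : ℝ) : ℂ) := by
    intro y
    rw [sub_apply, smul_apply, hΔ, hf]
    push_cast; rfl
  simp only [h2] at h
  rw [integral_complex_ofReal] at h
  exact_mod_cast h

/-! ### Convolution with a finite measure -/

section MeasureConvolution

variable {F : Type*} [NormedAddCommGroup F] {ν : Measure (Rn d)} [IsFiniteMeasure ν]

lemma quasiMeasurePreserving_sub_prod (ν : Measure (Rn d)) [SFinite ν] :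
    Measure.QuasiMeasurePreserving (fun q : Rn d × Rn d => q.1 - q.2)
      ((volume : Measure (Rn d)).prod ν) volume :=
  QuasiMeasurePreserving.prod_of_left (by fun_prop) <| Eventually.of_forall fun y =>
    (measurePreserving_sub_right volume y).quasiMeasurePreserving

lemma aestronglyMeasurable_sub_prod {f : Rn d → F} (hf : AEStronglyMeasurable f volume) :
    AEStronglyMeasurable (fun q : Rn d × Rn d => f (q.1 - q.2))
      ((volume : Measure (Rn d)).prod ν) :=
  hf.comp_quasiMeasurePreserving (quasiMeasurePreserving_sub_prod ν)

/-- Averaging translates against a finite measure `ν` increases the `L^p` norm at most by the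
factor `ν univ`. -/
lemma eLpNorm_lintegral_translate_le {p : ℝ≥0∞} (hp : 1 ≤ p) {f : Rn d → F}
    (hf : AEStronglyMeasurable f volume) :
    eLpNorm (fun x => ∫⁻ y, ‖f (x - y)‖ₑ ∂ν) p volume ≤ ν Set.univ * eLpNorm f p volume := by
  have hm := aestronglyMeasurable_sub_prod (ν := ν) hf
  rcases eq_or_ne p ∞ with rfl | hp'
  · have h0 : ∀ᵐ z : Rn d, ‖f z‖ₑ ≤ eLpNorm f ∞ volume := by
      rw [eLpNorm_exponent_top]; exact enorm_ae_le_eLpNormEssSup f volume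
    have h1 : ∀ᵐ q ∂((volume : Measure (Rn d)).prod ν), ‖f (q.1 - q.2)‖ₑ ≤ eLpNorm f ∞ volume :=
      (quasiMeasurePreserving_sub_prod ν).ae h0
    rw [eLpNorm_exponent_top]
    refine eLpNormEssSup_le_of_ae_enorm_bound ?_
    filter_upwards [Measure.ae_ae_of_ae_prod h1] with x hx
    calc ‖∫⁻ y, ‖f (x - y)‖ₑ ∂ν‖ₑ ≤ ∫⁻ _, eLpNorm f ∞ volume ∂ν := by
          simpa using lintegral_mono_ae hx
      _ = _ := by rw [lintegral_const, mul_comm]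
  · have hp0 : p ≠ 0 := (zero_lt_one.trans_le hp).ne'
    have hr : 1 ≤ p.toReal := by
      rwa [← ENNReal.toReal_one, ENNReal.toReal_le_toReal ENNReal.one_ne_top hp']
    set r := p.toReal with hrdef
    have hr0 : 0 < r := by linarith
    rw [eLpNorm_eq_lintegral_rpow_enorm_toReal hp0 hp',
      eLpNorm_eq_lintegral_rpow_enorm_toReal hp0 hp', ← hrdef, one_div,
      ENNReal.rpow_inv_le_iff hr0, ENNReal.mul_rpow_of_nonneg _ _ hr0.le,
      ENNReal.rpow_inv_rpow hr0.ne']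
    -- Hölder's inequality on the fibres: `(∫ |g| dν)^r ≤ ν(univ)^(r-1) ∫ |g|^r dν`.
    have h1 : ∀ᵐ x : Rn d, ‖∫⁻ y, ‖f (x - y)‖ₑ ∂ν‖ₑ ^ r
        ≤ ν Set.univ ^ (r - 1) * ∫⁻ y, ‖f (x - y)‖ₑ ^ r ∂ν := by
      filter_upwards [hm.prodMk_left] with x hx
      have h2 := eLpNorm_le_eLpNorm_mul_rpow_measure_univ (μ := ν) hp hx
      rw [eLpNorm_one_eq_lintegral_enorm, eLpNorm_eq_lintegral_rpow_enorm_toReal hp0 hp',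
        ← hrdef] at h2
      have h3 := ENNReal.rpow_le_rpow h2 hr0.le
      rw [ENNReal.mul_rpow_of_nonneg _ _ hr0.le, one_div, ENNReal.rpow_inv_rpow hr0.ne',
        ← ENNReal.rpow_mul, mul_comm] at h3
      rw [enorm_eq_self]
      convert h3 using 3
      rw [ENNReal.toReal_one]
      field_simp
    have hswap : ∫⁻ x : Rn d, ∫⁻ y, ‖f (x - y)‖ₑ ^ r ∂ν
        = ν Set.univ * ∫⁻ x : Rn d, ‖f x‖ₑ ^ r := by
      rw [lintegral_lintegral_swap (f := fun x y => ‖f (x - y)‖ₑ ^ r)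
        (hm.enorm.pow_const r)]
      simp_rw [fun y : Rn d => lintegral_sub_right_eq_self (μ := (volume : Measure (Rn d)))
        (fun x => ‖f x‖ₑ ^ r) y]
      rw [lintegral_const, mul_comm]
    refine (lintegral_mono_ae h1).trans ?_
    rw [lintegral_const_mul' _ _ (ENNReal.rpow_ne_top_of_nonneg (by linarith)
      (measure_ne_top ν _)), hswap, ← mul_assoc]
    gcongr
    rcases eq_or_ne (ν Set.univ) 0 with h0 | h0
    · simp [h0]
    · nth_rewrite 2 [← ENNReal.rpow_one (ν Set.univ)]
      rw [← ENNReal.rpow_add _ _ h0 (measure_ne_top ν _), sub_add_cancel]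

lemma eLpNorm_one_restrict_le {p : ℝ≥0∞} (hp : 1 ≤ p) {f : Rn d → F}
    (hf : AEStronglyMeasurable f volume) (K : Set (Rn d)) :
    eLpNorm f 1 (volume.restrict K) ≤ eLpNorm f p volume * volume K ^ (1 - 1 / p.toReal) := by
  have := eLpNorm_le_eLpNorm_mul_rpow_measure_univ (μ := volume.restrict K) hp hf.restrict
  rw [Measure.restrict_apply_univ, ENNReal.toReal_one, div_one] at this
  exact this.trans (by gcongr; exact Measure.restrict_le_self)

lemma one_sub_one_div_toReal_nonneg {p : ℝ≥0∞} (hp : 1 ≤ p) : 0 ≤ 1 - 1 / p.toReal := by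
  rcases eq_or_ne p ⊤ with rfl | hp'
  · simp
  · have hr : 1 ≤ p.toReal := by
      rwa [← ENNReal.toReal_one, ENNReal.toReal_le_toReal ENNReal.one_ne_top hp']
    rw [sub_nonneg, div_le_one (by linarith)]
    exact hr

lemma eLpNorm_comp_sub_right {p : ℝ≥0∞} {f : Rn d → F} (hf : AEStronglyMeasurable f volume)
    (y : Rn d) : eLpNorm (fun x => f (x - y)) p volume = eLpNorm f p volume :=
  eLpNorm_comp_measurePreserving hf (measurePreserving_sub_right volume y)

/-- On a set of finite measure, the translates of an `L^p` function are jointly integrable. -/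
lemma integrable_sub_prod_restrict {p : ℝ≥0∞} (hp : 1 ≤ p) {f : Rn d → F} (hf : MemLp f p)
    {K : Set (Rn d)} (hK : volume K ≠ ⊤) :
    Integrable (fun q : Rn d × Rn d => f (q.1 - q.2)) ((volume.restrict K).prod ν) := by
  have hm : AEStronglyMeasurable (fun q : Rn d × Rn d => f (q.1 - q.2))
      ((volume.restrict K).prod ν) :=
    (aestronglyMeasurable_sub_prod (ν := ν) hf.1).mono_ac
      (Measure.AbsolutelyContinuous.prod Measure.restrict_le_self.absolutelyContinuous
        Measure.AbsolutelyContinuous.rfl)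
  refine ⟨hm, ?_⟩
  have hC : eLpNorm f p volume * volume K ^ (1 - 1 / p.toReal) < ⊤ := by
    exact ENNReal.mul_lt_top hf.2
      (ENNReal.rpow_lt_top_of_nonneg (one_sub_one_div_toReal_nonneg hp) hK)
  rw [HasFiniteIntegral, lintegral_prod_symm _ hm.enorm]
  refine lt_of_le_of_lt (lintegral_mono (g := fun _ =>
    eLpNorm f p volume * volume K ^ (1 - 1 / p.toReal)) fun y => ?_) ?_
  · have h := eLpNorm_one_restrict_le hp (f := fun x => f (x - y))
      (hf.1.comp_measurePreserving (measurePreserving_sub_right volume y)) K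
    rwa [eLpNorm_one_eq_lintegral_enorm, eLpNorm_comp_sub_right hf.1] at h
  · rw [lintegral_const]
    exact ENNReal.mul_lt_top hC (measure_lt_top ν _)

lemma ae_integrable_translate {p : ℝ≥0∞} (hp : 1 ≤ p) {f : Rn d → F} (hf : MemLp f p) :
    ∀ᵐ x : Rn d, Integrable (fun y => f (x - y)) ν := by
  have h : ∀ n : ℕ, ∀ᵐ x : Rn d, x ∈ Metric.ball (0 : Rn d) n →
      Integrable (fun y => f (x - y)) ν := fun n => by
      rw [← ae_restrict_iff' measurableSet_ball]
      exact (integrable_sub_prod_restrict hp hf measure_ball_lt_top.ne).prod_right_ae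
  filter_upwards [ae_all_iff.2 h] with x hx
  obtain ⟨n, hn⟩ := exists_nat_gt ‖x‖
  exact hx n (by simpa using hn)

/-- Convolution with a finite measure, tested against a continuous compactly supported function. -/
lemma integral_smul_translate [NormedSpace ℝ F] [CompleteSpace F] {p : ℝ≥0∞} (hp : 1 ≤ p)
    {f : Rn d → F} (hf : MemLp f p) {ψ : Rn d → ℝ} (hψ : Continuous ψ) (hc : HasCompactSupport ψ) :
    ∫ x, ψ x • ∫ y, f (x - y) ∂ν = ∫ x, (∫ y, ψ (x + y) ∂ν) • f x := by
  obtain ⟨C, hC⟩ := hψ.bounded_above_of_compact_support hc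
  have hm : AEStronglyMeasurable (fun q : Rn d × Rn d => ψ q.1 • f (q.1 - q.2))
      ((volume : Measure (Rn d)).prod ν) :=
    (hψ.comp continuous_fst).aestronglyMeasurable.smul (aestronglyMeasurable_sub_prod hf.1)
  have hi : Integrable (fun q : Rn d × Rn d => ψ q.1 • f (q.1 - q.2))
      ((volume : Measure (Rn d)).prod ν) := by
    have h1 := (integrable_sub_prod_restrict (ν := ν) hp hf
      (hc.isCompact.measure_lt_top (μ := volume)).ne)
    have h2 : Integrable (fun q : Rn d × Rn d => ψ q.1 • f (q.1 - q.2))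
        ((volume.restrict (tsupport ψ)).prod ν) :=
      h1.bdd_smul C (hψ.comp continuous_fst).aestronglyMeasurable
        (Eventually.of_forall fun q => hC q.1)
    have h3 : (volume.restrict (tsupport ψ)).prod ν
        = ((volume : Measure (Rn d)).prod ν).restrict (tsupport ψ ×ˢ Set.univ) := by
      rw [← Measure.prod_restrict, Measure.restrict_univ]
    rw [h3] at h2
    refine (integrableOn_iff_integrable_of_support_subset ?_).1 h2
    intro q hq
    refine ⟨subset_tsupport _ fun h => hq ?_, trivial⟩
    simp [h]
  have hi' : Integrable (fun q : Rn d × Rn d => ψ (q.1 + q.2) • f q.1)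
      ((volume : Measure (Rn d)).prod ν) := by
    rw [integrable_prod_iff' (by
      exact (hψ.comp (by fun_prop)).aestronglyMeasurable.smul hf.1.comp_fst)]
    obtain ⟨h1, h2⟩ := (integrable_prod_iff' hm).1 hi
    constructor
    · filter_upwards [h1] with y hy
      have := hy.comp_add_right y
      simpa using this
    · refine h2.congr (Eventually.of_forall fun y => ?_)
      have := integral_add_right_eq_self (μ := (volume : Measure (Rn d)))
        (fun x => ‖ψ x • f (x - y)‖) y
      simp only [add_sub_cancel_right] at this
      exact this.symm
  calc ∫ x, ψ x • ∫ y, f (x - y) ∂ν = ∫ x, ∫ y, ψ x • f (x - y) ∂ν := by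
        simp_rw [integral_smul]
    _ = ∫ y, (∫ x, ψ x • f (x - y)) ∂ν := integral_integral_swap hi
    _ = ∫ y, (∫ x, ψ (x + y) • f x) ∂ν := by
        refine integral_congr_ae (Eventually.of_forall fun y => ?_)
        have := integral_add_right_eq_self (μ := (volume : Measure (Rn d)))
          (fun x => ψ x • f (x - y)) y
        simp only [add_sub_cancel_right] at this
        exact this.symm
    _ = ∫ x, (∫ y, ψ (x + y) • f x ∂ν) := (integral_integral_swap hi').symm
    _ = _ := by simp_rw [integral_smul_const]

end MeasureConvolution

/-! ### The free resolvent -/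

section Resolvent

variable {F : Type*} [NormedAddCommGroup F] [NormedSpace ℝ F]

/-- The resolvent `(a - Δ)⁻¹`, as the convolution with its kernel `resolventMeasure d a`. -/
noncomputable def resolvent (a : ℝ) (f : Rn d → F) : Rn d → F :=
  fun x => ∫ y, f (x - y) ∂(resolventMeasure d a)

variable {a : ℝ} {p : ℝ≥0∞} {f g : Rn d → F}

lemma aestronglyMeasurable_resolvent (ha : 0 < a) (hf : AEStronglyMeasurable f volume) :
    AEStronglyMeasurable (resolvent a f) volume := by
  have := isFiniteMeasure_resolventMeasure (d := d) ha
  exact (aestronglyMeasurable_sub_prod (ν := resolventMeasure d a) hf).integral_prod_right'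

lemma eLpNorm_resolvent_le (ha : 0 < a) (hp : 1 ≤ p) (hf : AEStronglyMeasurable f volume) :
    eLpNorm (resolvent a f) p volume ≤ ENNReal.ofReal a⁻¹ * eLpNorm f p volume := by
  have := isFiniteMeasure_resolventMeasure (d := d) ha
  rw [← resolventMeasure_univ (d := d) ha]
  refine le_trans (eLpNorm_mono_enorm fun x => ?_) (eLpNorm_lintegral_translate_le hp hf)
  rw [enorm_eq_self]
  exact enorm_integral_le_lintegral_enorm _

lemma memLp_resolvent (ha : 0 < a) (hp : 1 ≤ p) (hf : MemLp f p) : MemLp (resolvent a f) p :=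
  ⟨aestronglyMeasurable_resolvent ha hf.1, (eLpNorm_resolvent_le ha hp hf.1).trans_lt
    (ENNReal.mul_lt_top ENNReal.ofReal_lt_top hf.2)⟩

lemma resolvent_sub_ae (ha : 0 < a) (hp : 1 ≤ p) (hf : MemLp f p) (hg : MemLp g p) :
    resolvent a (fun x => f x - g x) =ᵐ[volume] fun x => resolvent a f x - resolvent a g x := by
  have := isFiniteMeasure_resolventMeasure (d := d) ha
  filter_upwards [ae_integrable_translate (ν := resolventMeasure d a) hp hf,
    ae_integrable_translate (ν := resolventMeasure d a) hp hg] with x h1 h2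
  exact integral_sub h1 h2

lemma resolvent_mono_ae (ha : 0 < a) (hp : 1 ≤ p) {f g : Rn d → ℝ} (hf : MemLp f p)
    (hg : MemLp g p) (h : f ≤ᵐ[volume] g) : resolvent a f ≤ᵐ[volume] resolvent a g := by
  have := isFiniteMeasure_resolventMeasure (d := d) ha
  have h1 := (quasiMeasurePreserving_sub_prod (resolventMeasure d a)).ae h
  filter_upwards [ae_integrable_translate (ν := resolventMeasure d a) hp hf,
    ae_integrable_translate (ν := resolventMeasure d a) hp hg,
    Measure.ae_ae_of_ae_prod h1] with x h1 h2 h3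
  exact integral_mono_ae h1 h2 h3

/-- `(a - Δ) (resolvent a f) = f` in the sense of distributions. -/
lemma integral_resolvent [CompleteSpace F] (ha : 0 < a) (hp : 1 ≤ p) (hf : MemLp f p)
    {φ : Rn d → ℝ} (hφ : IsTest φ) :
    ∫ x, (a * φ x - (Δ φ) x) • resolvent a f x = ∫ x, φ x • f x := by
  have := isFiniteMeasure_resolventMeasure (d := d) ha
  have h := integral_smul_translate (ν := resolventMeasure d a) hp hf
    (hφ.continuous_resolventOp a) (hφ.compact_resolventOp a)
  simp only [integral_resolventMeasure ha hφ] at h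
  exact h

end Resolvent

/-! ### Mollifiers -/

section Mollifier

/-- Bump functions at the origin, with radii `1 / (n + 1)` and `2 / (n + 1)`. -/
noncomputable def mollifierBump (d n : ℕ) : ContDiffBump (0 : Rn d) :=
  ⟨1 / ((n : ℝ) + 1), 2 / ((n : ℝ) + 1), by positivity, by gcongr; norm_num⟩

/-- The mollifiers: the bump functions `mollifierBump d n`, normalized to have integral `1`. -/
noncomputable def mollifier (d n : ℕ) : Rn d → ℝ := (mollifierBump d n).normed volume

lemma isTest_mollifier (n : ℕ) : IsTest (mollifier d n) :=
  ⟨(mollifierBump d n).contDiff_normed, (mollifierBump d n).hasCompactSupport_normed⟩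

lemma mollifier_nonneg (n : ℕ) (x : Rn d) : 0 ≤ mollifier d n x :=
  (mollifierBump d n).nonneg_normed x

lemma integral_mollifier (n : ℕ) : ∫ x, mollifier d n x = 1 :=
  (mollifierBump d n).integral_normed

lemma tendsto_rOut_mollifierBump :
    Tendsto (fun n => (mollifierBump d n).rOut) atTop (𝓝 0) := by
  have := (tendsto_one_div_add_atTop_nhds_zero_nat (𝕜 := ℝ)).const_mul 2
  simpa [mollifierBump, div_eq_mul_inv] using this

/-- Lebesgue's differentiation theorem for mollifications. -/
lemma ae_tendsto_mollify {F : Type*} [NormedAddCommGroup F] [NormedSpace ℝ F] [CompleteSpace F]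
    {z : Rn d → F} (hz : LocallyIntegrable z) :
    ∀ᵐ x, Tendsto (fun n => ∫ t, mollifier d n (x - t) • z t) atTop (𝓝 (z x)) := by
  have h := ContDiffBump.ae_convolution_tendsto_right_of_locallyIntegrable (K := 2)
    (tendsto_rOut_mollifierBump (d := d))
    (Eventually.of_forall fun n => by simp [mollifierBump, div_eq_mul_inv]) hz
  filter_upwards [h] with x hx
  refine hx.congr fun n => ?_
  rw [convolution_eq_swap]; rfl

lemma IsTest.comp_sub_left {φ : Rn d → ℝ} (h : IsTest φ) (x : Rn d) :
    IsTest fun t => φ (x - t) :=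
  ⟨h.smooth.comp (by fun_prop), hasCompactSupport_comp_sub_left h.compact x⟩

end Mollifier

/-! ### The comparison principle -/

section Comparison

/-- The maximum principle on the whole space, for bounded smooth subsolutions of `a - Δ`. -/
lemma nonpos_of_bounded_subsolution {a B : ℝ} (ha : 0 < a) {w : Rn d → ℝ} (hw : ContDiff ℝ 2 w)
    (hB : ∀ x, w x ≤ B) (h : ∀ x, a * w x ≤ (Δ w) x) (x : Rn d) : w x ≤ 0 := by
  -- The penalized function `w - δ |·|²` has a maximum point, where `Δ w ≤ 2 d δ`.
  have key : ∀ δ : ℝ, 0 < δ → w x ≤ δ * (2 * d / a + ‖x‖ ^ 2) := by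
    intro δ hδ
    have hcont : Continuous fun y : Rn d => δ * ‖y‖ ^ 2 - w y := by
      have := hw.continuous; fun_prop
    have hlim : Tendsto (fun y : Rn d => δ * ‖y‖ ^ 2 - w y) (cocompact (Rn d)) atTop := by
      refine tendsto_atTop_mono (f := fun y : Rn d => δ * ‖y‖ ^ 2 + (-B)) (fun y => ?_) ?_
      · linarith [hB y]
      · exact tendsto_atTop_add_const_right _ _ (((tendsto_pow_atTop two_ne_zero).comp
          (tendsto_norm_cocompact_atTop (E := Rn d))).const_mul_atTop hδ)
    obtain ⟨x₀, hx₀⟩ := hcont.exists_forall_le hlim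
    have hmin : IsLocalMin (δ • (fun y : Rn d => ‖y‖ ^ 2) - w) x₀ :=
      Eventually.of_forall fun y => by simpa using hx₀ y
    have hsq : ContDiff ℝ 2 (fun y : Rn d => ‖y‖ ^ 2) := contDiff_norm_sq ℝ
    have hsq' : ContDiff ℝ 2 (δ • fun y : Rn d => ‖y‖ ^ 2) := hsq.const_smul δ
    have h1 := laplacian_nonneg_of_isLocalMin (hsq'.sub hw) hmin
    change 0 ≤ (Δ (δ • (fun y : Rn d => ‖y‖ ^ 2) - w)) x₀ at h1
    rw [ContDiffAt.laplacian_sub hsq'.contDiffAt hw.contDiffAt,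
      InnerProductSpace.laplacian_smul δ hsq.contDiffAt, laplacian_norm_sq, smul_eq_mul] at h1
    have h2 := h x₀
    have h3 : w x₀ ≤ δ * (2 * d / a) := by
      rw [mul_div_assoc', le_div_iff₀ ha]; linarith
    have h4 := hx₀ x
    have h5 : 0 ≤ δ * ‖x₀‖ ^ 2 := by positivity
    linarith
  have hlim : Tendsto (fun δ : ℝ => δ * (2 * d / a + ‖x‖ ^ 2)) (𝓝[>] 0) (𝓝 0) := by
    have : Continuous fun δ : ℝ => δ * (2 * d / a + ‖x‖ ^ 2) := by fun_prop
    simpa using (this.tendsto 0).mono_left nhdsWithin_le_nhds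
  exact ge_of_tendsto hlim (eventually_mem_nhdsWithin.mono fun δ hδ => key δ hδ)

/-- Mollifications of `L^p` functions are bounded. -/
lemma exists_bound_mollify {p : ℝ≥0∞} (hp : 1 ≤ p) {z : Rn d → ℝ} (hz : MemLp z p)
    {ρ : Rn d → ℝ} (hρ : IsTest ρ) : ∃ B, ∀ x, ∫ t, ρ (x - t) * z t ≤ B := by
  obtain ⟨C, hC⟩ := hρ.continuous.bounded_above_of_compact_support hρ.compact
  set K := tsupport ρ
  have hK : volume K ≠ ⊤ := (hρ.compact.isCompact.measure_lt_top (μ := volume)).ne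
  have hM : eLpNorm z p volume * volume K ^ (1 - 1 / p.toReal) < ⊤ := by
    exact ENNReal.mul_lt_top hz.2
      (ENNReal.rpow_lt_top_of_nonneg (one_sub_one_div_toReal_nonneg hp) hK)
  refine ⟨C * (eLpNorm z p volume * volume K ^ (1 - 1 / p.toReal)).toReal, fun x => ?_⟩
  have hm : AEStronglyMeasurable (fun t => z (x - t)) volume :=
    hz.1.comp_measurePreserving (Measure.measurePreserving_sub_left volume x)
  have h1 := eLpNorm_one_restrict_le hp hm K
  have h2 : eLpNorm (fun t => z (x - t)) p volume = eLpNorm z p volume :=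
    eLpNorm_comp_measurePreserving hz.1 (Measure.measurePreserving_sub_left volume x)
  rw [h2] at h1
  have hi : Integrable (fun t => z (x - t)) (volume.restrict K) :=
    memLp_one_iff_integrable.1 ⟨hm.restrict, h1.trans_lt hM⟩
  have h3 : ∫ t in K, ‖z (x - t)‖
      ≤ (eLpNorm z p volume * volume K ^ (1 - 1 / p.toReal)).toReal := by
    rw [integral_norm_eq_lintegral_enorm hm.restrict, ← eLpNorm_one_eq_lintegral_enorm]
    exact ENNReal.toReal_mono hM.ne h1
  have h4 : ∫ t, ρ (x - t) * z t = ∫ t in K, ρ t * z (x - t) := by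
    rw [setIntegral_eq_integral_of_forall_compl_eq_zero, ← integral_sub_left_eq_self _ volume x]
    · simp
    · intro t ht
      rw [image_eq_zero_of_notMem_tsupport ht, zero_mul]
  rw [h4]
  have hC0 : 0 ≤ C := (norm_nonneg _).trans (hC 0)
  refine le_trans ?_ (mul_le_mul_of_nonneg_left h3 hC0)
  rw [← integral_const_mul]
  refine (Real.le_norm_self _).trans (norm_integral_le_of_norm_le (hi.norm.const_mul C)
    (Eventually.of_forall fun t => ?_))
  rw [norm_mul]
  exact mul_le_mul_of_nonneg_right (hC t) (norm_nonneg _)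

/-- Comparison principle for `a - Δ` in `L^p`: a distributional subsolution is nonpositive. -/
lemma ae_nonpos_of_subsolution {p : ℝ≥0∞} (hp : 1 ≤ p) {a : ℝ} (ha : 0 < a) {z : Rn d → ℝ}
    (hz : MemLp z p)
    (h : ∀ φ : Rn d → ℝ, IsTest φ → (∀ x, 0 ≤ φ x) → ∫ x, (a * φ x - (Δ φ) x) * z x ≤ 0) :
    ∀ᵐ x, z x ≤ 0 := by
  have hl : LocallyIntegrable z := hz.locallyIntegrable hp
  filter_upwards [ae_tendsto_mollify hl] with x hx
  refine le_of_tendsto hx (Eventually.of_forall fun n => ?_)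
  have hρ := isTest_mollifier (d := d) n
  obtain ⟨B, hB⟩ := exists_bound_mollify hp hz hρ
  refine nonpos_of_bounded_subsolution (w := fun x => ∫ t, mollifier d n (x - t) • z t) ha
    ((mollify_contDiff hρ hl).of_le (WithTop.coe_le_coe.2 le_top)) hB (fun y => ?_) x
  rw [laplacian_mollify hρ hl, ← integral_const_mul, ← sub_nonpos, ← integral_sub
    ((integrable_mollify hρ.continuous hρ.compact hl y).const_mul a)
    (integrable_mollify hρ.continuous_laplacian hρ.compact_laplacian hl y)]
  refine le_of_eq_of_le (integral_congr_ae (Eventually.of_forall fun t => ?_))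
    (h _ (hρ.comp_sub_left y) fun t => mollifier_nonneg n _)
  simp only [laplacian_comp_sub_left hρ.contDiff_two, smul_eq_mul]
  ring

end Comparison

/-! ### Local convergence of mollifications -/

section LocalConvergence

/-- Riesz' criterion: almost everywhere convergence, together with a bound of the `L¹` norms by
that of the limit, implies convergence in `L¹`. -/
lemma tendsto_lintegral_enorm_sub_of_lintegral_le {α F : Type*} [MeasurableSpace α]
    [NormedAddCommGroup F] {μ : Measure α} {f : ℕ → α → F} {g : α → F}
    (hf : ∀ n, AEStronglyMeasurable (f n) μ) (hg : AEStronglyMeasurable g μ)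
    (hfin : ∫⁻ x, ‖g x‖ₑ ∂μ ≠ ⊤) (hle : ∀ n, ∫⁻ x, ‖f n x‖ₑ ∂μ ≤ ∫⁻ x, ‖g x‖ₑ ∂μ)
    (hlim : ∀ᵐ x ∂μ, Tendsto (fun n => f n x) atTop (𝓝 (g x))) :
    Tendsto (fun n => ∫⁻ x, ‖f n x - g x‖ₑ ∂μ) atTop (𝓝 0) := by
  set A := ∫⁻ x, ‖g x‖ₑ ∂μ
  have hsub : ∀ n x, ‖f n x - g x‖ₑ ≤ ‖f n x‖ₑ + ‖g x‖ₑ := fun n x => enorm_sub_le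
  have hm : ∀ n, AEMeasurable (fun x => ‖f n x‖ₑ + ‖g x‖ₑ - ‖f n x - g x‖ₑ) μ := fun n =>
    ((hf n).enorm.add hg.enorm).sub ((hf n).sub hg).enorm
  -- Fatou's lemma for the nonnegative functions `‖f n‖ + ‖g‖ - ‖f n - g‖`.
  have hfatou : A + A ≤ liminf
      (fun n => ∫⁻ x, (‖f n x‖ₑ + ‖g x‖ₑ - ‖f n x - g x‖ₑ) ∂μ) atTop := by
    refine le_trans (le_of_eq ?_) (lintegral_liminf_le' hm)
    rw [← lintegral_add_left' hg.enorm]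
    refine lintegral_congr_ae ?_
    filter_upwards [hlim] with x hx
    have h1 : Tendsto (fun n => ‖f n x‖ₑ + ‖g x‖ₑ - ‖f n x - g x‖ₑ) atTop
        (𝓝 (‖g x‖ₑ + ‖g x‖ₑ - ‖g x - g x‖ₑ)) :=
      ENNReal.Tendsto.sub (hx.enorm.add tendsto_const_nhds) (hx.sub tendsto_const_nhds).enorm
        (Or.inl (by simp))
    rw [h1.liminf_eq]
    simp
  have hsum : ∀ n, ∫⁻ x, (‖f n x‖ₑ + ‖g x‖ₑ - ‖f n x - g x‖ₑ) ∂μ + ∫⁻ x, ‖f n x - g x‖ₑ ∂μ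
      ≤ A + A := fun n => by
    rw [← lintegral_add_left' (hm n)]
    simp only [tsub_add_cancel_of_le (hsub n _)]
    rw [lintegral_add_right' _ hg.enorm]
    exact add_le_add_left (hle n) _
  rw [ENNReal.tendsto_nhds_zero]
  intro ε hε
  rcases eq_or_ne A 0 with hA | hA
  · refine Eventually.of_forall fun n => ?_
    have := hsum n
    simp only [hA, add_zero, nonpos_iff_eq_zero, add_eq_zero] at this
    rw [this.2]; exact zero_le
  have hlt : A + A - ε < A + A :=
    ENNReal.sub_lt_self (by simp [hfin, A]) (by simp [hA]) hε.ne'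
  filter_upwards [eventually_lt_of_lt_liminf (hlt.trans_le hfatou)] with n hn
  have h1 := hsum n
  by_contra! hc
  have h2 : A + A < ∫⁻ x, (‖f n x‖ₑ + ‖g x‖ₑ - ‖f n x - g x‖ₑ) ∂μ + ∫⁻ x, ‖f n x - g x‖ₑ ∂μ :=
    calc A + A ≤ A + A - ε + ε := le_tsub_add
      _ < _ := ENNReal.add_lt_add hn hc
  exact absurd h1 (not_le.2 h2)

variable {F : Type*} [NormedAddCommGroup F] [NormedSpace ℝ F]

/-- Mollification is a contraction in `L¹`, being an average of translates against the probability
measure with density `mollifier d n`. -/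
lemma lintegral_enorm_mollify_le {z : Rn d → F} (hz : AEStronglyMeasurable z volume) (n : ℕ) :
    ∫⁻ x, ‖∫ t, mollifier d n (x - t) • z t‖ₑ ≤ ∫⁻ x, ‖z x‖ₑ := by
  set ν := (volume : Measure (Rn d)).withDensity fun t => ENNReal.ofReal (mollifier d n t)
  have hcont := (isTest_mollifier (d := d) n).continuous
  have hν : ν Set.univ = 1 := by
    rw [withDensity_apply _ MeasurableSet.univ, Measure.restrict_univ,
      ← ofReal_integral_eq_lintegral_ofReal
        (hcont.integrable_of_hasCompactSupport (isTest_mollifier n).compact)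
        (Eventually.of_forall fun t => mollifier_nonneg n t), integral_mollifier]
    simp
  have : IsFiniteMeasure ν := ⟨by simp [hν]⟩
  have h := eLpNorm_lintegral_translate_le (ν := ν) le_rfl hz
  rw [hν, one_mul, eLpNorm_one_eq_lintegral_enorm, eLpNorm_one_eq_lintegral_enorm] at h
  refine le_trans (lintegral_mono fun x => ?_) h
  rw [enorm_eq_self]
  have h1 : ∫ t, mollifier d n (x - t) • z t = ∫ t, z (x - t) ∂ν := by
    rw [integral_withDensity_eq_integral_toReal_smul
      (by have := hcont.measurable; fun_prop) (by simp),
      ← integral_sub_left_eq_self _ volume x]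
    simp [ENNReal.toReal_ofReal (mollifier_nonneg n _)]
  rw [h1]
  exact enorm_integral_le_lintegral_enorm _

/-- Mollifications converge in `L¹` on bounded sets. -/
lemma tendsto_mollify_L1_ball [CompleteSpace F] {z : Rn d → F} (hz : LocallyIntegrable z) (R : ℝ) :
    Tendsto (fun n => ∫⁻ x in Metric.ball 0 R, ‖(∫ t, mollifier d n (x - t) • z t) - z x‖ₑ)
      atTop (𝓝 0) := by
  set z' := (Metric.ball (0 : Rn d) (R + 2)).indicator z with hz'
  have hi : Integrable z' := by
    rw [hz', integrable_indicator_iff measurableSet_ball]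
    exact (hz.integrableOn_isCompact (isCompact_closedBall 0 (R + 2))).mono_set
      Metric.ball_subset_closedBall
  have hm : ∀ n, AEStronglyMeasurable (fun x => ∫ t, mollifier d n (x - t) • z' t) volume :=
    fun n => (mollify_contDiff (isTest_mollifier n)
      hi.locallyIntegrable).continuous.aestronglyMeasurable
  have h := tendsto_lintegral_enorm_sub_of_lintegral_le hm hi.1 hi.2.ne
    (fun n => lintegral_enorm_mollify_le hi.1 n) (ae_tendsto_mollify hi.locallyIntegrable)
  refine tendsto_of_tendsto_of_tendsto_of_le_of_le tendsto_const_nhds h (fun _ => zero_le)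
    fun n => ?_
  refine le_trans (le_of_eq ?_) (setLIntegral_le_lintegral (Metric.ball 0 R) _)
  refine setLIntegral_congr_fun measurableSet_ball fun x hx => ?_
  have hx' : ‖x‖ < R := by simpa using hx
  have e1 : z' x = z x := Set.indicator_of_mem (by simp; linarith) z
  have e2 : ∫ t, mollifier d n (x - t) • z' t = ∫ t, mollifier d n (x - t) • z t := by
    refine integral_congr_ae (Eventually.of_forall fun t => ?_)
    by_cases ht : mollifier d n (x - t) = 0
    · simp [ht]
    · have h1 : x - t ∈ Function.support (mollifier d n) := ht
      rw [mollifier, ContDiffBump.support_normed_eq] at h1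
      have h2 : ‖x - t‖ < 2 / ((n : ℝ) + 1) := by simpa [mollifierBump] using h1
      have h3 : 2 / ((n : ℝ) + 1) ≤ 2 := div_le_self (by norm_num) (by simp)
      have h4 : ‖t‖ ≤ ‖x‖ + ‖x - t‖ := by
        simpa using norm_sub_le x (x - t)
      have h5 : z' t = z t := Set.indicator_of_mem (by simp; linarith) z
      simp [h5]
  simp only [e1, e2]

end LocalConvergence

/-! ### The regularized norm -/

section RegularizedNorm

/-- The smooth convex regularization `√(‖v‖² + δ²)` of the norm. -/
noncomputable def regNorm (δ : ℝ) (v : Rn m) : ℝ := Real.sqrt (‖v‖ ^ 2 + δ ^ 2)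

variable {δ : ℝ}

lemma regNorm_sq (δ : ℝ) (v : Rn m) : regNorm δ v ^ 2 = ‖v‖ ^ 2 + δ ^ 2 :=
  Real.sq_sqrt (by positivity)

lemma regNorm_pos (hδ : 0 < δ) (v : Rn m) : 0 < regNorm δ v := Real.sqrt_pos.2 (by positivity)

lemma norm_le_regNorm (δ : ℝ) (v : Rn m) : ‖v‖ ≤ regNorm δ v :=
  Real.le_sqrt_of_sq_le (by nlinarith [sq_nonneg δ])

lemma regNorm_le (hδ : 0 < δ) (v : Rn m) : regNorm δ v ≤ ‖v‖ + δ :=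
  Real.sqrt_le_iff.2 ⟨by positivity, by nlinarith [norm_nonneg v]⟩

lemma contDiff_regNorm (hδ : 0 < δ) : ContDiff ℝ ∞ (regNorm (m := m) δ) :=
  ((contDiff_norm_sq ℝ).add contDiff_const).sqrt fun v => by positivity

/-- The subgradient inequality for the convex function `regNorm δ`. -/
lemma regNorm_subgradient (hδ : 0 < δ) (v w : Rn m) :
    regNorm δ v + ⟪v, w - v⟫_ℝ / regNorm δ v ≤ regNorm δ w := by
  have hv := regNorm_pos hδ v
  have hw := regNorm_pos hδ w
  have h1 : ⟪v, w⟫_ℝ ≤ ‖v‖ * ‖w‖ := real_inner_le_norm v w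
  have h2 : ‖v‖ * ‖w‖ + δ ^ 2 ≤ regNorm δ v * regNorm δ w := by
    refine abs_le_of_sq_le_sq' ?_ (by positivity) |>.2
    rw [mul_pow, regNorm_sq, regNorm_sq]
    nlinarith [sq_nonneg (δ * (‖v‖ - ‖w‖))]
  rw [← sub_nonneg]
  have h3 : regNorm δ w - (regNorm δ v + ⟪v, w - v⟫_ℝ / regNorm δ v)
      = (regNorm δ v * regNorm δ w - (δ ^ 2 + ⟪v, w⟫_ℝ)) / regNorm δ v := by
    rw [inner_sub_right, real_inner_self_eq_norm_sq]
    field_simp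
    rw [regNorm_sq]; ring
  rw [h3]
  exact div_nonneg (by linarith) hv.le

lemma abs_inner_div_regNorm_le (hδ : 0 < δ) (w v : Rn m) :
    |⟪w, v⟫_ℝ / regNorm δ v| ≤ ‖w‖ := by
  have hv := regNorm_pos hδ v
  rw [abs_div, abs_of_pos hv, div_le_iff₀ hv]
  exact (abs_real_inner_le_norm w v).trans
    (mul_le_mul_of_nonneg_left (norm_le_regNorm δ v) (norm_nonneg w))

lemma abs_regNorm_sub_le (hδ : 0 < δ) (v w : Rn m) : |regNorm δ v - regNorm δ w| ≤ ‖v - w‖ := by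
  have key : ∀ v w : Rn m, regNorm δ v - regNorm δ w ≤ ‖v - w‖ := fun v w => by
    have h1 := regNorm_subgradient hδ v w
    have h2 := (abs_le.1 (abs_inner_div_regNorm_le hδ (w - v) v)).1
    rw [real_inner_comm, norm_sub_rev] at h2
    linarith
  rw [abs_le]
  have := key w v
  rw [norm_sub_rev] at this
  exact ⟨by linarith, key v w⟩

end RegularizedNorm

/-! ### Kato's inequality -/

section KatoInequality

/-- Kato's inequality for smooth functions and the regularized norm. By convexity,
`y ↦ regNorm (u y) - ⟨b, u y⟩`, with `b` the gradient of the regularized norm at `u x`, has a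
minimum at `x`. -/
lemma le_laplacian_regNorm {δ : ℝ} (hδ : 0 < δ) {u : Rn d → Rn m} (hu : ContDiff ℝ 2 u)
    (x : Rn d) :
    ⟪(Δ u) x, u x⟫_ℝ / regNorm δ (u x) ≤ (Δ (fun y => regNorm δ (u y))) x := by
  set b : Rn m := (regNorm δ (u x))⁻¹ • u x
  have h1 : ContDiff ℝ 2 fun y => regNorm δ (u y) :=
    ((contDiff_regNorm hδ).of_le (WithTop.coe_le_coe.2 le_top)).comp hu
  have h2 : ContDiff ℝ 2 (innerSL ℝ b ∘ u) := (innerSL ℝ b).contDiff.comp hu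
  have hmin : IsLocalMin ((fun y => regNorm δ (u y)) - (innerSL ℝ b ∘ u)) x :=
    Eventually.of_forall fun y => by
      have := regNorm_subgradient hδ (u x) (u y)
      rw [inner_sub_right, sub_div] at this
      simp only [Pi.sub_apply, Function.comp_apply, innerSL_apply_apply, b, inner_smul_left,
        RCLike.conj_to_real, inv_mul_eq_div]
      linarith
  have h3 := laplacian_nonneg_of_isLocalMin (h1.sub h2) hmin
  change 0 ≤ (Δ ((fun y => regNorm δ (u y)) - (innerSL ℝ b ∘ u))) x at h3
  rw [ContDiffAt.laplacian_sub h1.contDiffAt h2.contDiffAt,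
    ContDiffAt.laplacian_CLM_comp_left hu.contDiffAt] at h3
  simp only [Function.comp_apply, innerSL_apply_apply, b, inner_smul_left, RCLike.conj_to_real,
    inv_mul_eq_div] at h3
  rw [real_inner_comm]
  linarith

/-- The integrated form of `le_laplacian_regNorm`. -/
lemma kato_smooth {δ : ℝ} (hδ : 0 < δ) {u : Rn d → Rn m} (hu : ContDiff ℝ ∞ u)
    {φ : Rn d → ℝ} (hφ : IsTest φ) (hφ0 : ∀ x, 0 ≤ φ x) :
    ∫ x, φ x * (⟪(Δ u) x, u x⟫_ℝ / regNorm δ (u x)) ≤ ∫ x, (Δ φ) x * regNorm δ (u x) := by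
  have hN : ContDiff ℝ ∞ fun y => regNorm δ (u y) := (contDiff_regNorm hδ).comp hu
  have hN2 : ContDiff ℝ 2 fun y => regNorm δ (u y) := hN.of_le (WithTop.coe_le_coe.2 le_top)
  have h := integral_mul_laplacian hN2 hφ
  have h' : ∫ x, (Δ φ) x * regNorm δ (u x) = ∫ x, φ x * (Δ (fun y => regNorm δ (u y))) x := by
    simp_rw [mul_comm ((Δ φ) _), mul_comm (φ _)]; exact h
  rw [h']
  have hu2 : ContDiff ℝ 2 u := hu.of_le (WithTop.coe_le_coe.2 le_top)
  have c1 : Continuous (Δ u) := continuous_laplacian hu2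
  have c2 : Continuous (Δ (fun y => regNorm δ (u y))) := continuous_laplacian hN2
  refine integral_mono ?_ ?_ fun x =>
    mul_le_mul_of_nonneg_left (le_laplacian_regNorm hδ hu2 x) (hφ0 x)
  · refine Continuous.integrable_of_hasCompactSupport ?_ hφ.compact.mul_right
    exact hφ.continuous.mul ((c1.inner hu.continuous).div hN.continuous
      fun x => (regNorm_pos hδ _).ne')
  · exact (hφ.continuous.mul c2).integrable_of_hasCompactSupport hφ.compact.mul_right

lemma exists_forall_eq_zero_of_notMem_ball {f : Rn d → ℝ} (hf : HasCompactSupport f) :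
    ∃ R, ∀ S, R ≤ S → ∀ x, x ∉ Metric.ball (0 : Rn d) S → f x = 0 := by
  obtain ⟨R, hR⟩ := hf.isCompact.isBounded.subset_ball 0
  exact ⟨R, fun S hS x hx => image_eq_zero_of_notMem_tsupport fun h =>
    hx (Metric.ball_subset_ball hS (hR h))⟩

/-- Convergence of integrals over a ball, for integrands controlled by a sequence converging in
`L¹` there. -/
lemma tendsto_integral_of_le_L1_ball {E : Type*} [NormedAddCommGroup E] [NormedSpace ℝ E]
    {R C : ℝ} {G : ℕ → Rn d → Rn m} {G' : Rn d → Rn m}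
    (hG : Tendsto (fun n => ∫⁻ x in Metric.ball 0 R, ‖G n x - G' x‖ₑ) atTop (𝓝 0))
    {H : ℕ → Rn d → E} {H' : Rn d → E} (hi : ∀ n, Integrable (H n)) (hi' : Integrable H')
    (hle : ∀ n x, ‖H n x - H' x‖ ≤ C * ‖G n x - G' x‖)
    (hz : ∀ n x, x ∉ Metric.ball (0 : Rn d) R → H n x - H' x = 0) :
    Tendsto (fun n => ∫ x, H n x) atTop (𝓝 (∫ x, H' x)) := by
  refine tendsto_integral_of_L1 H' hi'.1 (Eventually.of_forall hi) ?_
  have h1 : Tendsto (fun n => ENNReal.ofReal C * ∫⁻ x in Metric.ball 0 R, ‖G n x - G' x‖ₑ) atTop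
      (𝓝 0) := by
    simpa using ENNReal.Tendsto.const_mul hG (Or.inr ENNReal.ofReal_ne_top)
  refine tendsto_of_tendsto_of_tendsto_of_le_of_le tendsto_const_nhds h1 (fun _ => zero_le)
    fun n => ?_
  rw [← lintegral_const_mul' _ _ ENNReal.ofReal_ne_top,
    ← setLIntegral_eq_of_support_subset (s := Metric.ball (0 : Rn d) R)]
  · refine lintegral_mono fun x => ?_
    simp only
    rw [← ofReal_norm, ← ofReal_norm, ← ENNReal.ofReal_mul' (norm_nonneg _)]
    exact ENNReal.ofReal_le_ofReal (hle n x)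
  · intro x hx
    by_contra hx'
    exact hx (by simp only [hz n x hx', enorm_zero])

lemma integrable_mul_inner_div_regNorm {δ : ℝ} (hδ : 0 < δ) {u F : Rn d → Rn m}
    (hu : AEStronglyMeasurable u volume) (hF : LocallyIntegrable F) {φ : Rn d → ℝ}
    (hφ : IsTest φ) : Integrable fun x => φ x * (⟪F x, u x⟫_ℝ / regNorm δ (u x)) := by
  refine (integrable_test_smul hφ.continuous hφ.compact hF).norm.mono' ?_
    (Eventually.of_forall fun x => ?_)
  · have h1 := (contDiff_regNorm (m := m) hδ).continuous.comp_aestronglyMeasurable hu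
    exact hφ.continuous.aestronglyMeasurable.mul ((hF.aestronglyMeasurable.inner hu).div₀ h1)
  · rw [norm_mul, norm_smul]
    exact mul_le_mul_of_nonneg_left (abs_inner_div_regNorm_le hδ _ _) (norm_nonneg _)

/-- Kato's inequality for the regularized norm, from the smooth case by mollification: `Δ u = F` is
preserved by mollification, and both sides converge by convergence in `L¹` on balls. -/
lemma kato_regularized {δ : ℝ} (hδ : 0 < δ) {u F : Rn d → Rn m} (hu : LocallyIntegrable u)
    (hF : LocallyIntegrable F)
    (h : ∀ φ : Rn d → ℝ, IsTest φ → ∫ x, (Δ φ) x • u x = ∫ x, φ x • F x)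
    {φ : Rn d → ℝ} (hφ : IsTest φ) (hφ0 : ∀ x, 0 ≤ φ x) :
    ∫ x, φ x * (⟪F x, u x⟫_ℝ / regNorm δ (u x)) ≤ ∫ x, (Δ φ) x * regNorm δ (u x) := by
  obtain ⟨R₁, hR₁⟩ := exists_forall_eq_zero_of_notMem_ball hφ.compact
  obtain ⟨R₂, hR₂⟩ := exists_forall_eq_zero_of_notMem_ball hφ.compact_laplacian
  set R := max R₁ R₂
  obtain ⟨C₁, hC₁⟩ := hφ.continuous.bounded_above_of_compact_support hφ.compact
  obtain ⟨C₂, hC₂⟩ :=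
    hφ.continuous_laplacian.bounded_above_of_compact_support hφ.compact_laplacian
  set un : ℕ → Rn d → Rn m := fun n x => ∫ t, mollifier d n (x - t) • u t with hun
  set Fn : ℕ → Rn d → Rn m := fun n x => ∫ t, mollifier d n (x - t) • F t with hFn
  have hunC : ∀ n, ContDiff ℝ ∞ (un n) := fun n => mollify_contDiff (isTest_mollifier n) hu
  have hFnC : ∀ n, ContDiff ℝ ∞ (Fn n) := fun n => mollify_contDiff (isTest_mollifier n) hF
  have hN := contDiff_regNorm (m := m) hδ
  have hlap : ∀ n x, (Δ (un n)) x = Fn n x := fun n x => by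
    have hρ := isTest_mollifier (d := d) n
    rw [hun, hFn, laplacian_mollify hρ hu]
    simp only
    rw [← h _ (hρ.comp_sub_left x)]
    simp only [laplacian_comp_sub_left hρ.contDiff_two]
  have hiF : ∀ n, Integrable fun x => φ x * (⟪F x, un n x⟫_ℝ / regNorm δ (un n x)) := fun n =>
    integrable_mul_inner_div_regNorm hδ (hunC n).continuous.aestronglyMeasurable hF hφ
  have hiFn : ∀ n, Integrable fun x => φ x * (⟪Fn n x, un n x⟫_ℝ / regNorm δ (un n x)) :=
    fun n => integrable_mul_inner_div_regNorm hδ (hunC n).continuous.aestronglyMeasurable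
      (hFnC n).continuous.locallyIntegrable hφ
  have hiN : ∀ v : Rn d → Rn m, LocallyIntegrable v →
      Integrable fun x => (Δ φ) x * regNorm δ (v x) := fun v hv => by
    refine ((integrable_test_smul hφ.continuous_laplacian hφ.compact_laplacian hv).norm.add
      ((hφ.continuous_laplacian.integrable_of_hasCompactSupport
        hφ.compact_laplacian).norm.mul_const δ)).mono' ?_ (Eventually.of_forall fun x => ?_)
    · exact hφ.continuous_laplacian.aestronglyMeasurable.mul
        (hN.continuous.comp_aestronglyMeasurable hv.aestronglyMeasurable)
    · simp only [norm_mul, Pi.add_apply, norm_smul]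
      rw [← mul_add, Real.norm_of_nonneg (regNorm_pos hδ _).le]
      exact mul_le_mul_of_nonneg_left (regNorm_le hδ _) (norm_nonneg _)
  have hright : Tendsto (fun n => ∫ x, (Δ φ) x * regNorm δ (un n x)) atTop
      (𝓝 (∫ x, (Δ φ) x * regNorm δ (u x))) := by
    refine tendsto_integral_of_le_L1_ball (C := C₂) (tendsto_mollify_L1_ball hu R)
      (fun n => hiN _ (hunC n).continuous.locallyIntegrable) (hiN u hu) (fun n x => ?_)
      fun n x hx => by rw [hR₂ R (le_max_right _ _) x hx]; ring
    rw [← mul_sub, norm_mul]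
    exact mul_le_mul (hC₂ x) (abs_regNorm_sub_le hδ _ _) (abs_nonneg _)
      ((norm_nonneg _).trans (hC₂ x))
  have hleft1 : Tendsto (fun n => ∫ x, (φ x * (⟪Fn n x, un n x⟫_ℝ / regNorm δ (un n x))
      - φ x * (⟪F x, un n x⟫_ℝ / regNorm δ (un n x)))) atTop (𝓝 (∫ _ : Rn d, (0 : ℝ))) := by
    refine tendsto_integral_of_le_L1_ball (C := C₁) (tendsto_mollify_L1_ball hF R)
      (fun n => (hiFn n).sub (hiF n)) (integrable_zero _ _ _) (fun n x => ?_)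
      fun n x hx => by rw [hR₁ R (le_max_left _ _) x hx]; ring
    rw [sub_zero, ← mul_sub, ← sub_div, ← inner_sub_left, norm_mul]
    exact mul_le_mul (hC₁ x) (abs_inner_div_regNorm_le hδ _ _) (abs_nonneg _)
      ((norm_nonneg _).trans (hC₁ x))
  have hleft2 : Tendsto (fun n => ∫ x, φ x * (⟪F x, un n x⟫_ℝ / regNorm δ (un n x))) atTop
      (𝓝 (∫ x, φ x * (⟪F x, u x⟫_ℝ / regNorm δ (u x)))) := by
    refine tendsto_integral_of_dominated_convergence (fun x => ‖φ x • F x‖)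
      (fun n => (hiF n).1) (integrable_test_smul hφ.continuous hφ.compact hF).norm
      (fun n => Eventually.of_forall fun x => ?_) ?_
    · rw [norm_mul, norm_smul]
      exact mul_le_mul_of_nonneg_left (abs_inner_div_regNorm_le hδ _ _) (norm_nonneg _)
    · filter_upwards [ae_tendsto_mollify hu] with x hx
      exact ((tendsto_const_nhds.inner hx).div ((hN.continuous.tendsto _).comp hx)
        (regNorm_pos hδ _).ne').const_mul (φ x)
  refine le_of_tendsto_of_tendsto' (b := atTop) (f := fun n =>
    (∫ x, (φ x * (⟪Fn n x, un n x⟫_ℝ / regNorm δ (un n x))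
      - φ x * (⟪F x, un n x⟫_ℝ / regNorm δ (un n x))))
    + ∫ x, φ x * (⟪F x, un n x⟫_ℝ / regNorm δ (un n x))) ?_ hright fun n => ?_
  · simpa using hleft1.add hleft2
  · rw [integral_sub (hiFn n) (hiF n), sub_add_cancel]
    simpa only [hlap] using kato_smooth hδ (hunC n) hφ hφ0

/-- Kato's inequality `Δ|u| ≥ ⟨Δu, u⟩ / |u|` for vector-valued functions, in the sense of
distributions. The right-hand side is read as `0` where `u` vanishes. -/
theorem kato_inequality {u F : Rn d → Rn m} (hu : LocallyIntegrable u) (hF : LocallyIntegrable F)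
    (h : ∀ φ : Rn d → ℝ, IsTest φ → ∫ x, (Δ φ) x • u x = ∫ x, φ x • F x)
    {φ : Rn d → ℝ} (hφ : IsTest φ) (hφ0 : ∀ x, 0 ≤ φ x) :
    ∫ x, φ x * (⟪F x, u x⟫_ℝ / ‖u x‖) ≤ ∫ x, (Δ φ) x * ‖u x‖ := by
  set δ : ℕ → ℝ := fun n => 1 / ((n : ℝ) + 1)
  have hδ : ∀ n, 0 < δ n := fun n => by positivity
  have hδ1 : ∀ n, δ n ≤ 1 := fun n => div_le_self zero_le_one (by simp)
  have hδ0 : Tendsto δ atTop (𝓝 0) := tendsto_one_div_add_atTop_nhds_zero_nat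
  have hlim : ∀ v : Rn m, Tendsto (fun n => regNorm (δ n) v) atTop (𝓝 ‖v‖) := fun v => by
    have : Tendsto (fun n => Real.sqrt (‖v‖ ^ 2 + δ n ^ 2)) atTop
        (𝓝 (Real.sqrt (‖v‖ ^ 2 + 0 ^ 2))) := (tendsto_const_nhds.add (hδ0.pow 2)).sqrt
    simpa [regNorm] using this
  refine le_of_tendsto_of_tendsto' (b := atTop) (f := fun n =>
      ∫ x, φ x * (⟪F x, u x⟫_ℝ / regNorm (δ n) (u x)))
    (g := fun n => ∫ x, (Δ φ) x * regNorm (δ n) (u x)) ?_ ?_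
    fun n => kato_regularized (hδ n) hu hF h hφ hφ0
  · refine tendsto_integral_of_dominated_convergence (fun x => ‖φ x • F x‖)
      (fun n => (integrable_mul_inner_div_regNorm (hδ n) hu.aestronglyMeasurable hF hφ).1)
      (integrable_test_smul hφ.continuous hφ.compact hF).norm
      (fun n => Eventually.of_forall fun x => ?_) (Eventually.of_forall fun x => ?_)
    · rw [norm_mul, norm_smul]
      exact mul_le_mul_of_nonneg_left (abs_inner_div_regNorm_le (hδ n) _ _) (norm_nonneg _)
    · refine Tendsto.const_mul (φ x) ?_
      by_cases h0 : u x = 0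
      · simp [h0]
      · exact tendsto_const_nhds.div (hlim _) (norm_ne_zero_iff.2 h0)
  · refine tendsto_integral_of_dominated_convergence (fun x => ‖(Δ φ) x‖ * ‖u x‖ + ‖(Δ φ) x‖)
      (fun n => ?_) ?_ (fun n => Eventually.of_forall fun x => ?_)
      (Eventually.of_forall fun x => (hlim (u x)).const_mul _)
    · exact hφ.continuous_laplacian.aestronglyMeasurable.mul
        ((contDiff_regNorm (hδ n)).continuous.comp_aestronglyMeasurable hu.aestronglyMeasurable)
    · have h1 := (integrable_test_smul hφ.continuous_laplacian hφ.compact_laplacian hu).norm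
      simp only [norm_smul] at h1
      exact h1.add (hφ.continuous_laplacian.integrable_of_hasCompactSupport
        hφ.compact_laplacian).norm
    · rw [norm_mul, Real.norm_of_nonneg (regNorm_pos (hδ n) _).le, ← mul_add_one]
      refine mul_le_mul_of_nonneg_left ((regNorm_le (hδ n) _).trans ?_) (norm_nonneg _)
      linarith [hδ1 n]

end KatoInequality

/-! ### Nonnegative definite matrices -/

section Matrix

variable {A : Matrix (Fin m) (Fin m) ℝ}

/-- The sum of the absolute values of the entries; it bounds the operator norm. -/
noncomputable def entrySum (A : Matrix (Fin m) (Fin m) ℝ) : ℝ := ∑ i, ∑ j, |A i j|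

lemma entrySum_nonneg (A : Matrix (Fin m) (Fin m) ℝ) : 0 ≤ entrySum A :=
  Finset.sum_nonneg fun _ _ => Finset.sum_nonneg fun _ _ => abs_nonneg _

lemma entrySum_smul (c : ℝ) (A : Matrix (Fin m) (Fin m) ℝ) :
    entrySum (c • A) = |c| * entrySum A := by
  simp [entrySum, abs_mul, Finset.mul_sum]

lemma toEuclideanLin_apply_coord (A : Matrix (Fin m) (Fin m) ℝ) (ξ : Rn m) (i : Fin m) :
    A.toEuclideanLin ξ i = ∑ j, A i j * ξ j := by
  simp [Matrix.toEuclideanLin, Matrix.mulVec, dotProduct]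

lemma norm_le_sum_abs (v : Rn m) : ‖v‖ ≤ ∑ i, |v i| := by
  rw [EuclideanSpace.norm_eq]
  refine Real.sqrt_le_iff.2 ⟨Finset.sum_nonneg fun _ _ => abs_nonneg _, ?_⟩
  simp only [Real.norm_eq_abs]
  exact Finset.sum_sq_le_sq_sum_of_nonneg fun _ _ => abs_nonneg _

lemma norm_toEuclideanLin_le (A : Matrix (Fin m) (Fin m) ℝ) (ξ : Rn m) :
    ‖A.toEuclideanLin ξ‖ ≤ entrySum A * ‖ξ‖ := by
  refine (norm_le_sum_abs _).trans ?_
  rw [entrySum, Finset.sum_mul]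
  refine Finset.sum_le_sum fun i _ => ?_
  rw [toEuclideanLin_apply_coord, Finset.sum_mul]
  refine (Finset.abs_sum_le_sum_abs _ _).trans (Finset.sum_le_sum fun j _ => ?_)
  rw [abs_mul]
  exact mul_le_mul_of_nonneg_left (by simpa using PiLp.norm_apply_le ξ j) (abs_nonneg _)

lemma isSymmetric_toEuclideanLin (hA : ∀ i j, A i j = A j i) : A.toEuclideanLin.IsSymmetric := by
  rw [Matrix.isSymmetric_toEuclideanLin_iff]
  ext i j
  simp [hA i j]

/-- A symmetric operator `A` with `0 ≤ A ≤ M` satisfies `|(M - A) ξ| ≤ M |ξ|`. -/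
lemma norm_smul_sub_toEuclideanLin_le (hs : ∀ i j, A i j = A j i)
    (hp : ∀ ξ : Rn m, 0 ≤ ⟪A.toEuclideanLin ξ, ξ⟫_ℝ) {M : ℝ} (hM : 0 < M) (hA : entrySum A ≤ M)
    (ξ : Rn m) : ‖M • ξ - A.toEuclideanLin ξ‖ ≤ M * ‖ξ‖ := by
  set T := A.toEuclideanLin
  have hbound : ‖T (T ξ)‖ ≤ M * ‖T ξ‖ :=
    (norm_toEuclideanLin_le A _).trans (mul_le_mul_of_nonneg_right hA (norm_nonneg _))
  -- Positivity of the form at `M ξ - T ξ` gives `|T ξ|² ≤ M ⟨T ξ, ξ⟩`.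
  have h1 : ‖T ξ‖ ^ 2 ≤ M * ⟪T ξ, ξ⟫_ℝ := by
    have h2 := hp (M • ξ - T ξ)
    have h3 : ⟪T (T ξ), ξ⟫_ℝ = ‖T ξ‖ ^ 2 := by
      rw [isSymmetric_toEuclideanLin hs, real_inner_self_eq_norm_sq]
    have h4 : ⟪T (T ξ), T ξ⟫_ℝ ≤ M * ‖T ξ‖ ^ 2 := by
      refine (real_inner_le_norm _ _).trans ?_
      nlinarith [norm_nonneg (T ξ)]
    simp only [map_sub, map_smul, inner_sub_left, inner_sub_right, inner_smul_left,
      inner_smul_right, RCLike.conj_to_real] at h2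
    change 0 ≤ _ at h2
    rw [h3, real_inner_self_eq_norm_sq] at h2
    nlinarith
  refine abs_le_of_sq_le_sq' ?_ (by positivity) |>.2
  rw [norm_sub_sq_real, norm_smul, inner_smul_left, RCLike.conj_to_real, real_inner_comm,
    Real.norm_of_nonneg hM.le]
  nlinarith

/-- Nonnegativity of the form makes the set in the definition of `minEig` bounded below. -/
lemma minEig_mul_norm_sq_le (hp : ∀ ξ : Rn m, 0 ≤ ⟪A.toEuclideanLin ξ, ξ⟫_ℝ) (ξ : Rn m) :
    minEig A * ‖ξ‖ ^ 2 ≤ ⟪A.toEuclideanLin ξ, ξ⟫_ℝ := by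
  rcases eq_or_ne ξ 0 with rfl | hξ
  · simp
  have hn : 0 < ‖ξ‖ := norm_pos_iff.2 hξ
  have h1 : minEig A ≤ ⟪A.toEuclideanLin (‖ξ‖⁻¹ • ξ), ‖ξ‖⁻¹ • ξ⟫_ℝ :=
    csInf_le ⟨0, by rintro r ⟨u, -, rfl⟩; exact hp u⟩
      ⟨‖ξ‖⁻¹ • ξ, by rw [norm_smul, norm_inv, norm_norm, inv_mul_cancel₀ hn.ne'], rfl⟩
  rw [map_smul, inner_smul_left, inner_smul_right, RCLike.conj_to_real, ← mul_assoc,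
    ← mul_inv, ← pow_two, inv_mul_eq_div, le_div_iff₀ (by positivity)] at h1
  exact h1

/-- Expansion in an orthonormal basis of eigenvectors; the eigenvalues are nonnegative. -/
lemma norm_toEuclideanLin_le_maxEig (hs : ∀ i j, A i j = A j i)
    (hp : ∀ ξ : Rn m, 0 ≤ ⟪A.toEuclideanLin ξ, ξ⟫_ℝ) (ξ : Rn m) :
    ‖A.toEuclideanLin ξ‖ ≤ maxEig A * ‖ξ‖ := by
  set T := A.toEuclideanLin
  have hT : T.IsSymmetric := isSymmetric_toEuclideanLin hs
  have hfin : Module.finrank ℝ (Rn m) = m := by simp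
  set b := hT.eigenvectorBasis hfin
  set l := hT.eigenvalues hfin
  have hbdd : BddAbove {r : ℝ | Module.End.HasEigenvalue T r} :=
    (Module.End.finite_hasEigenvalue T).bddAbove
  have hl : ∀ i, l i ≤ maxEig A := fun i => le_csSup hbdd (hT.hasEigenvalue_eigenvalues hfin i)
  have hl0 : ∀ i, 0 ≤ l i := fun i => by
    have h1 := hp (b i)
    have h2 : T (b i) = l i • b i := hT.apply_eigenvectorBasis hfin i
    change 0 ≤ ⟪T (b i), b i⟫_ℝ at h1
    rw [h2, inner_smul_left, real_inner_self_eq_norm_sq, b.orthonormal.1 i] at h1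
    simpa using h1
  have hcoord : ∀ i, ⟪b i, T ξ⟫_ℝ = l i * ⟪b i, ξ⟫_ℝ := fun i => by
    have h2 : T (b i) = l i • b i := hT.apply_eigenvectorBasis hfin i
    rw [← hT, h2, inner_smul_left]; rfl
  rcases Nat.eq_zero_or_pos m with rfl | hm
  · have h0 : ξ = 0 := Subsingleton.elim _ _
    simp [h0]
  have hmax : 0 ≤ maxEig A := (hl0 ⟨0, hm⟩).trans (hl _)
  refine abs_le_of_sq_le_sq' ?_ (by positivity) |>.2
  rw [mul_pow, ← b.sum_sq_inner_right (T ξ), ← b.sum_sq_inner_right ξ, Finset.mul_sum]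
  refine Finset.sum_le_sum fun i _ => ?_
  rw [hcoord, mul_pow]
  exact mul_le_mul_of_nonneg_right (pow_le_pow_left₀ (hl0 i) (hl i) 2) (sq_nonneg _)

/-- If the eigenvalues are comparable, `A ξ` is controlled by the quadratic form:
`|A ξ| |ξ| ≤ Λ |ξ|² ≤ C λ |ξ|² ≤ C ⟨A ξ, ξ⟩`. -/
lemma norm_mul_norm_le_of_comparable (hs : ∀ i j, A i j = A j i)
    (hp : ∀ ξ : Rn m, 0 ≤ ⟪A.toEuclideanLin ξ, ξ⟫_ℝ) {C : ℝ} (hC : 0 ≤ C)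
    (h : maxEig A ≤ C * minEig A) (ξ : Rn m) :
    ‖A.toEuclideanLin ξ‖ * ‖ξ‖ ≤ C * ⟪A.toEuclideanLin ξ, ξ⟫_ℝ := by
  have h1 := norm_toEuclideanLin_le_maxEig hs hp ξ
  have h2 := mul_le_mul_of_nonneg_left (minEig_mul_norm_sq_le hp ξ) hC
  have h3 := mul_le_mul_of_nonneg_right h1 (norm_nonneg ξ)
  have h4 := mul_le_mul_of_nonneg_right h (sq_nonneg ‖ξ‖)
  nlinarith

end Matrix

/-! ### Matrix potentials -/

section MulField

lemma locallyIntegrable_norm {F : Type*} [NormedAddCommGroup F] {f : Rn d → F}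
    (hf : LocallyIntegrable f) : LocallyIntegrable fun x => ‖f x‖ := fun x => (hf x).norm

variable {V : Rn d → Matrix (Fin m) (Fin m) ℝ} {u v : Rn d → Rn m}

lemma aestronglyMeasurable_mulField (hV : ∀ i j, AEStronglyMeasurable (fun x => V x i j) volume)
    (hu : AEStronglyMeasurable u volume) : AEStronglyMeasurable (mulField V u) volume := by
  have h1 : AEMeasurable (fun x => fun i => ∑ j, V x i j * u x j) (volume : Measure (Rn d)) := by
    refine aemeasurable_pi_lambda _ fun i => Finset.aemeasurable_fun_sum _ fun j _ => ?_
    exact (hV i j).aemeasurable.mul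
      ((EuclideanSpace.proj (𝕜 := ℝ) j).continuous.comp_aestronglyMeasurable hu).aemeasurable
  have h2 : mulField V u = fun x => WithLp.toLp 2 (fun i => ∑ j, V x i j * u x j) := by
    ext x i
    exact toEuclideanLin_apply_coord _ _ _
  rw [h2]
  exact (PiLp.continuous_toLp 2 _).comp_aestronglyMeasurable h1.aestronglyMeasurable

lemma norm_mulField_le (V : Rn d → Matrix (Fin m) (Fin m) ℝ) (u : Rn d → Rn m) (x : Rn d) :
    ‖mulField V u x‖ ≤ entrySum (V x) * ‖u x‖ := norm_toEuclideanLin_le _ _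

lemma IsPotential.aestronglyMeasurable (hV : IsPotential V) (i j : Fin m) :
    AEStronglyMeasurable (fun x => V x i j) volume :=
  (hV.locallyIntegrable i j).aestronglyMeasurable

lemma IsPotential.locallyIntegrable_entrySum (hV : IsPotential V) :
    LocallyIntegrable (fun x => entrySum (V x)) := by
  unfold entrySum
  exact locallyIntegrable_finsetSum _ fun i _ => locallyIntegrable_finsetSum _ fun j _ =>
    locallyIntegrable_norm (hV.locallyIntegrable i j)

end MulField

/-! ### Distributional solutions and their domination -/

section Solutions

variable {V W : Rn d → Matrix (Fin m) (Fin m) ℝ} {a : ℝ} {u v f g h : Rn d → Rn m} {p : ℝ≥0∞}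

/-- `(a - Δ + V) u = h` in the sense of distributions, all terms being locally integrable. -/
structure IsSolution (V : Rn d → Matrix (Fin m) (Fin m) ℝ) (a : ℝ) (u h : Rn d → Rn m) :
    Prop where
  left : LocallyIntegrable u
  pot : LocallyIntegrable (mulField V u)
  right : LocallyIntegrable h
  eq : ∀ φ : Rn d → ℝ, IsTest φ →
    (∫ x, (a * φ x - (Δ φ) x) • u x) + ∫ x, φ x • mulField V u x = ∫ x, φ x • h x

lemma mulField_sub (V : Rn d → Matrix (Fin m) (Fin m) ℝ) (u v : Rn d → Rn m) :
    mulField V (fun x => u x - v x) = fun x => mulField V u x - mulField V v x := by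
  ext x : 1
  simp [mulField]

lemma IsTest.integrable_smul {φ : Rn d → ℝ} (hφ : IsTest φ) (hf : LocallyIntegrable f) :
    Integrable fun x => φ x • f x := integrable_test_smul hφ.continuous hφ.compact hf

lemma IsTest.integrable_resolventOp_smul {φ : Rn d → ℝ} (hφ : IsTest φ) (a : ℝ)
    (hf : LocallyIntegrable f) : Integrable fun x => (a * φ x - (Δ φ) x) • f x :=
  integrable_test_smul (hφ.continuous_resolventOp a) (hφ.compact_resolventOp a) hf

lemma IsTest.integrable_mul {φ g : Rn d → ℝ} (hφ : IsTest φ) (hg : LocallyIntegrable g) :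
    Integrable fun x => φ x * g x :=
  hg.integrable_smul_left_of_hasCompactSupport hφ.continuous hφ.compact

lemma IsTest.integrable_resolventOp_mul {φ g : Rn d → ℝ} (hφ : IsTest φ) (a : ℝ)
    (hg : LocallyIntegrable g) : Integrable fun x => (a * φ x - (Δ φ) x) * g x :=
  hg.integrable_smul_left_of_hasCompactSupport (hφ.continuous_resolventOp a)
    (hφ.compact_resolventOp a)

lemma IsSolution.congr {u' h' : Rn d → Rn m} (hs : IsSolution V a u h) (hu : u =ᵐ[volume] u')
    (hh : h =ᵐ[volume] h') : IsSolution V a u' h' := by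
  refine ⟨hs.left.congr hu, hs.pot.congr (mulField_ae_congr hu), hs.right.congr hh,
    fun φ hφ => ?_⟩
  have h1 : ∫ x, (a * φ x - (Δ φ) x) • u' x = ∫ x, (a * φ x - (Δ φ) x) • u x :=
    integral_congr_ae (hu.mono fun x hx => by simp only [hx])
  have h2 : ∫ x, φ x • mulField V u' x = ∫ x, φ x • mulField V u x :=
    integral_congr_ae ((mulField_ae_congr (V := V) hu).mono fun x hx => by simp only [hx])
  have h3 : ∫ x, φ x • h' x = ∫ x, φ x • h x :=
    integral_congr_ae (hh.mono fun x hx => by simp only [hx])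
  rw [h1, h2, h3, hs.eq φ hφ]

lemma IsSolution.sub (h₁ : IsSolution V a u f) (h₂ : IsSolution V a v g) :
    IsSolution V a (fun x => u x - v x) (fun x => f x - g x) := by
  refine ⟨h₁.left.sub h₂.left, ?_, h₁.right.sub h₂.right, fun φ hφ => ?_⟩
  · rw [mulField_sub]; exact h₁.pot.sub h₂.pot
  · rw [mulField_sub]
    simp only [smul_sub]
    rw [integral_sub (hφ.integrable_resolventOp_smul a h₁.left)
        (hφ.integrable_resolventOp_smul a h₂.left),
      integral_sub (hφ.integrable_smul h₁.pot) (hφ.integrable_smul h₂.pot),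
      integral_sub (hφ.integrable_smul h₁.right) (hφ.integrable_smul h₂.right),
      ← h₁.eq φ hφ, ← h₂.eq φ hφ]
    abel

/-- A solution for `V` solves the equation for `W`, with `(W - V) u` moved to the right-hand
side. -/
lemma IsSolution.change_potential (hs : IsSolution V a u h)
    (hW : LocallyIntegrable (mulField W u)) :
    IsSolution W a u (fun x => h x + (mulField W u x - mulField V u x)) := by
  refine ⟨hs.left, hW, hs.right.add (hW.sub hs.pot), fun φ hφ => ?_⟩
  have h1 : Integrable fun x => φ x • mulField W u x - φ x • mulField V u x :=
    (hφ.integrable_smul hW).sub (hφ.integrable_smul hs.pot)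
  simp only [smul_add, smul_sub]
  rw [integral_add (hφ.integrable_smul hs.right) h1,
    integral_sub (hφ.integrable_smul hW) (hφ.integrable_smul hs.pot), ← hs.eq φ hφ]
  abel

lemma integral_resolventOp_smul {φ : Rn d → ℝ} (hφ : IsTest φ) (a : ℝ)
    (hf : LocallyIntegrable f) : ∫ x, (a * φ x - (Δ φ) x) • f x
      = a • (∫ x, φ x • f x) - ∫ x, (Δ φ) x • f x := by
  have h1 : Integrable fun x => a • φ x • f x := (hφ.integrable_smul hf).smul a
  rw [← integral_smul, ← integral_sub h1
    (integrable_test_smul hφ.continuous_laplacian hφ.compact_laplacian hf)]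
  simp only [sub_smul, mul_smul]

lemma integral_resolventOp_mul {φ g : Rn d → ℝ} (hφ : IsTest φ) (a : ℝ)
    (hg : LocallyIntegrable g) : ∫ x, (a * φ x - (Δ φ) x) * g x
      = a * (∫ x, φ x * g x) - ∫ x, (Δ φ) x * g x := by
  have h1 : Integrable fun x => (Δ φ) x * g x :=
    hg.integrable_smul_left_of_hasCompactSupport hφ.continuous_laplacian hφ.compact_laplacian
  rw [← integral_const_mul, ← integral_sub ((hφ.integrable_mul hg).const_mul a) h1]
  simp only [sub_mul, mul_assoc]

/-- Kato's inequality for solutions: `(a - Δ) |u| + ⟨V u, u⟩ / |u| ≤ |h|`. -/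
lemma IsSolution.kato (hs : IsSolution V a u h) {φ : Rn d → ℝ} (hφ : IsTest φ)
    (hφ0 : ∀ x, 0 ≤ φ x) :
    Integrable (fun x => φ x * (⟪mulField V u x, u x⟫_ℝ / ‖u x‖)) ∧
    (∫ x, (a * φ x - (Δ φ) x) * ‖u x‖) + ∫ x, φ x * (⟪mulField V u x, u x⟫_ℝ / ‖u x‖)
      ≤ ∫ x, φ x * ‖h x‖ := by
  have hdiv : ∀ w v : Rn m, |⟪w, v⟫_ℝ / ‖v‖| ≤ ‖w‖ := fun w v => by
    rcases eq_or_ne v 0 with rfl | hv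
    · simp
    · rw [abs_div, abs_norm, div_le_iff₀ (norm_pos_iff.2 hv)]
      exact abs_real_inner_le_norm w v
  have hint : ∀ {w : Rn d → Rn m}, LocallyIntegrable w →
      Integrable (fun x => φ x * (⟪w x, u x⟫_ℝ / ‖u x‖)) := fun {w} hw => by
    refine (hφ.integrable_smul hw).norm.mono' ?_ (Eventually.of_forall fun x => ?_)
    · exact hφ.continuous.aestronglyMeasurable.mul
        ((hw.aestronglyMeasurable.inner hs.left.aestronglyMeasurable).div₀
          hs.left.aestronglyMeasurable.norm)
    · rw [norm_mul, norm_smul]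
      exact mul_le_mul_of_nonneg_left (hdiv _ _) (norm_nonneg _)
  refine ⟨hint hs.pot, ?_⟩
  have hF : LocallyIntegrable fun x => a • u x + mulField V u x - h x :=
    ((hs.left.smul a).add hs.pot).sub hs.right
  have hk := kato_inequality hs.left hF (fun ψ hψ => ?_) hφ hφ0
  · have hnu := locallyIntegrable_norm hs.left
    have e : ∀ x, φ x * (⟪a • u x + mulField V u x - h x, u x⟫_ℝ / ‖u x‖)
        = a * (φ x * ‖u x‖) + φ x * (⟪mulField V u x, u x⟫_ℝ / ‖u x‖)
          - φ x * (⟪h x, u x⟫_ℝ / ‖u x‖) := fun x => by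
      rcases eq_or_ne (u x) 0 with h0 | h0
      · simp [h0]
      · have := norm_ne_zero_iff.2 h0
        rw [inner_sub_left, inner_add_left, inner_smul_left, RCLike.conj_to_real,
          real_inner_self_eq_norm_sq]
        field_simp
    simp only [e] at hk
    have hi : Integrable fun x =>
        a * (φ x * ‖u x‖) + φ x * (⟪mulField V u x, u x⟫_ℝ / ‖u x‖) :=
      ((hφ.integrable_mul hnu).const_mul a).add (hint hs.pot)
    rw [integral_sub hi (hint hs.right),
      integral_add ((hφ.integrable_mul hnu).const_mul a) (hint hs.pot), integral_const_mul] at hk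
    have hh : ∫ x, φ x * (⟪h x, u x⟫_ℝ / ‖u x‖) ≤ ∫ x, φ x * ‖h x‖ :=
      integral_mono (hint hs.right) (hφ.integrable_mul (locallyIntegrable_norm hs.right))
        fun x => mul_le_mul_of_nonneg_left ((le_abs_self _).trans (hdiv _ _)) (hφ0 x)
    rw [integral_resolventOp_mul hφ a hnu]
    linarith
  · have h1 := hs.eq ψ hψ
    rw [integral_resolventOp_smul hψ a hs.left] at h1
    simp only [smul_add, smul_sub]
    have i1 : Integrable fun x => ψ x • a • u x := hψ.integrable_smul (hs.left.smul a)
    have i2 : Integrable fun x => ψ x • a • u x + ψ x • mulField V u x :=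
      i1.add (hψ.integrable_smul hs.pot)
    rw [integral_sub i2 (hψ.integrable_smul hs.right), integral_add i1 (hψ.integrable_smul hs.pot),
      ← h1]
    simp_rw [smul_comm (ψ _) a]
    rw [integral_smul]
    abel

/-- Domination of solutions by the free resolvent: by Kato's inequality `|u|` is a subsolution of
`(a - Δ) z = |h|`, of which `resolvent a |h|` is a solution. -/
lemma IsSolution.norm_le_resolvent (ha : 0 < a) (hp : 1 ≤ p)
    (hV : ∀ᵐ x, ∀ ξ : Rn m, 0 ≤ ⟪(V x).toEuclideanLin ξ, ξ⟫_ℝ)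
    (hs : IsSolution V a u h) (hu : MemLp u p) (hh : MemLp h p) :
    ∀ᵐ x, ‖u x‖ ≤ resolvent a (fun y => ‖h y‖) x := by
  have hR := memLp_resolvent ha hp hh.norm
  have key := ae_nonpos_of_subsolution hp ha (hu.norm.sub hR) fun φ hφ hφ0 => ?_
  · filter_upwards [key] with x hx
    simpa using hx
  · obtain ⟨hi, hk⟩ := hs.kato hφ hφ0
    have hRe := integral_resolvent ha hp hh.norm hφ
    have hnn : 0 ≤ ∫ x, φ x * (⟪mulField V u x, u x⟫_ℝ / ‖u x‖) := by
      refine integral_nonneg_of_ae ?_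
      filter_upwards [hV] with x hx
      exact mul_nonneg (hφ0 x) (div_nonneg (hx _) (norm_nonneg _))
    simp only [smul_eq_mul] at hRe
    simp only [Pi.sub_apply, mul_sub]
    rw [integral_sub (hφ.integrable_resolventOp_mul a (locallyIntegrable_norm hs.left))
      (hφ.integrable_resolventOp_mul a (hR.locallyIntegrable hp)), hRe]
    linarith

lemma IsSolution.eLpNorm_le (ha : 0 < a) (hp : 1 ≤ p)
    (hV : ∀ᵐ x, ∀ ξ : Rn m, 0 ≤ ⟪(V x).toEuclideanLin ξ, ξ⟫_ℝ)
    (hs : IsSolution V a u h) (hu : MemLp u p) (hh : MemLp h p) :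
    eLpNorm u p volume ≤ ENNReal.ofReal a⁻¹ * eLpNorm h p volume := by
  have h1 : eLpNorm u p volume ≤ eLpNorm (resolvent a fun y => ‖h y‖) p volume := by
    refine eLpNorm_mono_ae ?_
    filter_upwards [hs.norm_le_resolvent ha hp hV hu hh] with x hx
    exact hx.trans (Real.le_norm_self _)
  refine h1.trans ((eLpNorm_resolvent_le ha hp hh.norm.1).trans_eq ?_)
  rw [eLpNorm_norm]

end Solutions

/-! ### Dissipativity -/

section KatoPair

variable {V : Rn d → Matrix (Fin m) (Fin m) ℝ} {p : ℝ≥0∞} [Fact (1 ≤ p)]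

lemma isSolution_of_isKatoPair {f g : LpSpace d m p} (a : ℝ) (h : IsKatoPair V p f g) :
    IsSolution V a f (fun x => a • f x + g x) := by
  have hf := locallyIntegrable_Lp f
  have hg := locallyIntegrable_Lp g
  refine ⟨hf, h.1, (hf.smul a).add hg, fun φ hφ => ?_⟩
  have h1 := h.2 φ hφ.smooth hφ.compact
  simp only [smul_add]
  have i1 : Integrable fun x => φ x • a • f x := hφ.integrable_smul (hf.smul a)
  rw [integral_add i1 (hφ.integrable_smul hg), ← h1,
    integral_resolventOp_smul hφ a hf]
  simp_rw [smul_comm (φ _) a]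
  rw [integral_smul]
  abel

lemma isKatoPair_of_isSolution {f h : LpSpace d m p} {a : ℝ} (hs : IsSolution V a f h) :
    IsKatoPair V p f (h - a • f) := by
  have hf := locallyIntegrable_Lp f
  refine ⟨hs.pot, fun φ h1 h2 => ?_⟩
  have hφ : IsTest φ := ⟨h1, h2⟩
  have h3 := hs.eq φ hφ
  rw [integral_resolventOp_smul hφ a hf] at h3
  have h4 : ∫ x, φ x • (h - a • f : LpSpace d m p) x
      = (∫ x, φ x • h x) - a • ∫ x, φ x • f x := by
    have i1 : Integrable fun x => a • φ x • f x := (hφ.integrable_smul hf).smul a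
    rw [← integral_smul, ← integral_sub (hφ.integrable_smul hs.right) i1]
    refine integral_congr_ae ?_
    filter_upwards [Lp.coeFn_sub h (a • f), Lp.coeFn_smul a f] with x e1 e2
    rw [e1, Pi.sub_apply, e2, Pi.smul_apply, smul_sub, smul_comm (φ x) a]
  rw [h4, ← h3]
  abel

/-- Dissipativity of the realization of `Δ - V`. -/
lemma isDissipative_neg_katoOp (hV : ∀ᵐ x, ∀ ξ : Rn m, 0 ≤ ⟪(V x).toEuclideanLin ξ, ξ⟫_ℝ) :
    IsDissipative (-(katoOp V p)) := by
  intro a ha (u : (katoOp V p).domain)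
  have hp : 1 ≤ p := Fact.out
  have hpair : IsKatoPair V p (u : LpSpace d m p) (katoOp V p u) :=
    (mem_graph_katoOp V p _ _).1 (LinearPMap.mem_graph _ u)
  set f : LpSpace d m p := (u : LpSpace d m p)
  set g : LpSpace d m p := katoOp V p u
  have e : a • f - (-(katoOp V p)) u = a • f + g := by
    rw [LinearPMap.neg_apply, sub_neg_eq_add]
  have hs : IsSolution V a f (a • f + g : LpSpace d m p) := by
    refine (isSolution_of_isKatoPair a hpair).congr (EventuallyEq.refl _ _) ?_
    filter_upwards [Lp.coeFn_add (a • f) g, Lp.coeFn_smul a f] with x e1 e2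
    rw [e1, Pi.add_apply, e2, Pi.smul_apply]
  have h1 := hs.eLpNorm_le ha hp hV (Lp.memLp f) (Lp.memLp _)
  have h2 := ENNReal.toReal_mono
    (ENNReal.mul_ne_top ENNReal.ofReal_ne_top (Lp.memLp (a • f + g)).2.ne) h1
  rw [ENNReal.toReal_mul, ENNReal.toReal_ofReal (inv_nonneg.2 ha.le), ← Lp.norm_def,
    ← Lp.norm_def, inv_mul_eq_div, le_div_iff₀ ha] at h2
  rw [e]
  linarith

end KatoPair

/-! ### Bounded potentials -/

section BoundedPotential

variable {V : Rn d → Matrix (Fin m) (Fin m) ℝ} {a M : ℝ} {f : Rn d → Rn m}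

/-- For a bounded potential `0 ≤ V ≤ M` the equation `(a - Δ + V) u = f` is solved by Banach's fixed
point theorem in `L¹`, from the equivalent form `u = (a + M - Δ)⁻¹ (f + (M - V) u)`. -/
lemma exists_isSolution_of_bounded (hm : ∀ i j, AEStronglyMeasurable (fun x => V x i j) volume)
    (hsymm : ∀ᵐ x, ∀ i j, V x i j = V x j i)
    (hpos : ∀ᵐ x, ∀ ξ : Rn m, 0 ≤ ⟪(V x).toEuclideanLin ξ, ξ⟫_ℝ) (hM : 0 < M)
    (hb : ∀ᵐ x, entrySum (V x) ≤ M) (ha : 0 < a) (hf : MemLp f 1) :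
    ∃ u, MemLp u 1 ∧ IsSolution V a u f := by
  have hab : 0 < a + M := by positivity
  set Φ : (Rn d → Rn m) → Rn d → Rn m := fun u x => f x + (M • u x - mulField V u x) with hΦ
  have hbound : ∀ u : Rn d → Rn m, ∀ᵐ x, ‖M • u x - mulField V u x‖ ≤ M * ‖u x‖ := fun u => by
    filter_upwards [hsymm, hpos, hb] with x h1 h2 h3
    exact norm_smul_sub_toEuclideanLin_le h1 h2 hM h3 _
  have hVu : ∀ u : Rn d → Rn m, MemLp u 1 → MemLp (mulField V u) 1 := fun u hu => by
    refine (hu.norm.const_mul M).of_le (aestronglyMeasurable_mulField hm hu.1) ?_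
    filter_upwards [hb] with x hx
    refine (norm_mulField_le V u x).trans ((mul_le_mul_of_nonneg_right hx (norm_nonneg _)).trans ?_)
    exact Real.le_norm_self _
  have hΦm : ∀ u : Rn d → Rn m, MemLp u 1 → MemLp (Φ u) 1 := fun u hu =>
    hf.add ((hu.const_smul M).sub (hVu u hu))
  set S : LpSpace d m 1 → LpSpace d m 1 := fun u =>
    (memLp_resolvent hab le_rfl (hΦm u (Lp.memLp u))).toLp _ with hS
  set K : NNReal := Real.toNNReal ((a + M)⁻¹ * M)
  have hK : K < 1 := by
    rw [Real.toNNReal_lt_one, inv_mul_eq_div, div_lt_one hab]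
    linarith
  have hLip : LipschitzWith K S := fun u v => by
    rw [hS, Lp.edist_toLp_toLp]
    have h1 : resolvent (a + M) (Φ u) - resolvent (a + M) (Φ v)
        =ᵐ[volume] resolvent (a + M) (fun x => Φ u x - Φ v x) :=
      (resolvent_sub_ae hab le_rfl (hΦm u (Lp.memLp u)) (hΦm v (Lp.memLp v))).symm
    rw [eLpNorm_congr_ae h1]
    refine (eLpNorm_resolvent_le hab le_rfl
      ((hΦm u (Lp.memLp u)).1.sub (hΦm v (Lp.memLp v)).1)).trans ?_
    have h2 : eLpNorm (fun x => Φ u x - Φ v x) 1 volume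
        ≤ ENNReal.ofReal M * eLpNorm (fun x => u x - v x) 1 volume := by
      refine eLpNorm_le_mul_eLpNorm_of_ae_le_mul ?_ 1
      filter_upwards [hbound (fun x => u x - v x)] with x hx
      rw [mulField_sub, smul_sub] at hx
      refine le_trans (le_of_eq ?_) hx
      simp only [hΦ]
      congr 1
      abel
    calc _ ≤ ENNReal.ofReal (a + M)⁻¹
          * (ENNReal.ofReal M * eLpNorm (fun x => u x - v x) 1 volume) := by gcongr; exact h2
      _ = _ := by
        rw [← mul_assoc, ← ENNReal.ofReal_mul (by positivity), Lp.edist_def]; rfl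
  obtain ⟨u, hu, -⟩ := ContractingWith.exists_fixedPoint (⟨hK, hLip⟩ : ContractingWith K S) 0
    (edist_ne_top _ _)
  have huL := Lp.memLp u
  have hul : LocallyIntegrable u := huL.locallyIntegrable le_rfl
  have hVl : LocallyIntegrable (mulField V u) := (hVu u huL).locallyIntegrable le_rfl
  have hfl : LocallyIntegrable f := hf.locallyIntegrable le_rfl
  refine ⟨u, huL, hul, hVl, hfl, fun φ hφ => ?_⟩
  have hfix : (u : Rn d → Rn m) =ᵐ[volume] resolvent (a + M) (Φ u) := by
    have h1 := MemLp.coeFn_toLp (memLp_resolvent hab le_rfl (hΦm u huL))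
    have h2 : (memLp_resolvent hab le_rfl (hΦm u huL)).toLp _ = u := hu
    rwa [h2] at h1
  have h1 := integral_resolvent hab le_rfl (hΦm u huL) hφ
  have h2 : ∫ x, ((a + M) * φ x - (Δ φ) x) • u x
      = ∫ x, ((a + M) * φ x - (Δ φ) x) • resolvent (a + M) (Φ u) x :=
    integral_congr_ae (hfix.mono fun x hx => by simp only [hx])
  rw [← h2, integral_resolventOp_smul hφ _ hul] at h1
  have i1 : Integrable fun x => φ x • M • u x := hφ.integrable_smul (hul.smul M)
  have i2 : Integrable fun x => φ x • M • u x - φ x • mulField V u x :=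
    i1.sub (hφ.integrable_smul hVl)
  simp only [hΦ, smul_add, smul_sub] at h1
  rw [integral_add (hφ.integrable_smul hfl) i2, integral_sub i1 (hφ.integrable_smul hVl)] at h1
  simp_rw [smul_comm (φ _) M] at h1
  rw [integral_smul, add_smul] at h1
  rw [integral_resolventOp_smul hφ a hul]
  have h3 : ∀ A B C D E : Rn m, A + B - C = D + (B - E) → A - C + E = D := by
    intro A B C D E h
    have : A = D + (B - E) - B + C := by rw [← h]; abel
    rw [this]; abel
  exact h3 _ _ _ _ _ h1

end BoundedPotential

/-! ### Cutoff functions -/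

section Cutoff

/-- A smooth bump function on `ℝᵈ`, equal to `1` on the unit ball. -/
noncomputable def unitBump (d : ℕ) : ContDiffBump (0 : Rn d) := ⟨1, 2, one_pos, one_lt_two⟩

/-- The smooth cutoff `x ↦ unitBump (x / (n + 1))`, equal to `1` on the ball of radius `n + 1`. -/
noncomputable def cutoff (d n : ℕ) (x : Rn d) : ℝ := unitBump d (((n : ℝ) + 1)⁻¹ • x)

lemma isTest_unitBump : IsTest (unitBump d : Rn d → ℝ) :=
  ⟨(unitBump d).contDiff, (unitBump d).hasCompactSupport⟩

lemma isTest_cutoff (n : ℕ) : IsTest (cutoff d n) := by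
  have hn : ((n : ℝ) + 1)⁻¹ ≠ 0 := by positivity
  refine ⟨(unitBump d).contDiff.comp (by fun_prop), ?_⟩
  have h1 := (unitBump d).hasCompactSupport.comp_homeomorph (Homeomorph.smulOfNeZero _ hn)
  have h2 : cutoff d n = (unitBump d : Rn d → ℝ) ∘ (Homeomorph.smulOfNeZero _ hn) := by
    ext x; simp [cutoff]
  rwa [h2]

lemma cutoff_nonneg (n : ℕ) (x : Rn d) : 0 ≤ cutoff d n x := (unitBump d).nonneg

lemma cutoff_le_one (n : ℕ) (x : Rn d) : cutoff d n x ≤ 1 := (unitBump d).le_one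

lemma cutoff_eq_one {n : ℕ} {x : Rn d} (hx : ‖x‖ ≤ n + 1) : cutoff d n x = 1 := by
  refine (unitBump d).one_of_mem_closedBall ?_
  have : ‖((n : ℝ) + 1)⁻¹ • x‖ ≤ 1 := by
    rw [norm_smul, norm_inv, Real.norm_of_nonneg (by positivity), inv_mul_eq_div,
      div_le_one (by positivity)]
    exact hx
  simpa [unitBump] using this

lemma tendsto_cutoff (x : Rn d) : Tendsto (fun n => cutoff d n x) atTop (𝓝 1) := by
  obtain ⟨N, hN⟩ := exists_nat_gt ‖x‖
  refine tendsto_const_nhds.congr' ?_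
  filter_upwards [eventually_ge_atTop N] with n hn
  have : (N : ℝ) ≤ n := by exact_mod_cast hn
  exact (cutoff_eq_one (by linarith)).symm

/-- By scaling, the Laplacian of the cutoff is of order `(n + 1)⁻²`. -/
lemma exists_abs_laplacian_cutoff_le (d : ℕ) :
    ∃ C, 0 ≤ C ∧ ∀ (n : ℕ) (x : Rn d), |(Δ (cutoff d n)) x| ≤ C * (((n : ℝ) + 1)⁻¹) ^ 2 := by
  have h := isTest_unitBump (d := d)
  obtain ⟨C, hC⟩ := h.continuous_laplacian.bounded_above_of_compact_support h.compact_laplacian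
  refine ⟨C, (norm_nonneg _).trans (hC 0), fun n x => ?_⟩
  have h1 := laplacian_comp_affine h.contDiff_two (((n : ℝ) + 1)⁻¹) 0 x
  simp only [add_zero] at h1
  have h2 : (Δ (cutoff d n)) x = (((n : ℝ) + 1)⁻¹) ^ 2 • (Δ (unitBump d : Rn d → ℝ))
      (((n : ℝ) + 1)⁻¹ • x) := h1
  rw [h2, smul_eq_mul, abs_mul, abs_of_nonneg (by positivity), mul_comm]
  exact mul_le_mul_of_nonneg_right (hC _) (by positivity)

end Cutoff

/-! ### Locally integrable potentials, bounded integrable right-hand sides -/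

section Truncation

variable {V : Rn d → Matrix (Fin m) (Fin m) ℝ} {a : ℝ} {f : Rn d → Rn m}

/-- The damping factor `(n + 1) / (n + 1 + s)`, increasing to `1` with `n`. -/
noncomputable def damping (n : ℕ) (s : ℝ) : ℝ := ((n : ℝ) + 1) / ((n : ℝ) + 1 + s)

lemma damping_nonneg (n : ℕ) {s : ℝ} (hs : 0 ≤ s) : 0 ≤ damping n s := by
  unfold damping; positivity

lemma damping_le_one (n : ℕ) {s : ℝ} (hs : 0 ≤ s) : damping n s ≤ 1 :=
  (div_le_one (by positivity)).2 (by linarith)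

lemma damping_mul_le (n : ℕ) {s : ℝ} (hs : 0 ≤ s) : damping n s * s ≤ n + 1 := by
  rw [damping, div_mul_eq_mul_div, div_le_iff₀ (by positivity)]
  nlinarith [mul_nonneg (by positivity : (0:ℝ) ≤ (n : ℝ) + 1) (by positivity : (0:ℝ) ≤ (n:ℝ) + 1)]

lemma damping_mono {n k : ℕ} (h : n ≤ k) {s : ℝ} (hs : 0 ≤ s) : damping n s ≤ damping k s := by
  have : (n : ℝ) ≤ k := by exact_mod_cast h
  rw [damping, damping, div_le_div_iff₀ (by positivity) (by positivity)]
  nlinarith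

lemma tendsto_damping {s : ℝ} (hs : 0 ≤ s) : Tendsto (fun n => damping n s) atTop (𝓝 1) := by
  have h1 : Tendsto (fun n : ℕ => (n : ℝ) + 1 + s) atTop atTop :=
    tendsto_atTop_add_const_right _ _
      (tendsto_atTop_add_const_right _ _ tendsto_natCast_atTop_atTop)
  have h2 : Tendsto (fun n : ℕ => 1 - s / ((n : ℝ) + 1 + s)) atTop (𝓝 (1 - 0)) :=
    tendsto_const_nhds.sub (tendsto_const_nhds.div_atTop h1)
  rw [sub_zero] at h2
  refine h2.congr fun n => ?_
  have : (n : ℝ) + 1 + s ≠ 0 := by positivity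
  rw [damping]
  field_simp
  ring

/-- The bounded potential obtained from `V` by damping with `entrySum V`: a scalar multiple of
`V(x)` at each point, hence symmetric and nonnegative definite as well. -/
noncomputable def truncPotential (V : Rn d → Matrix (Fin m) (Fin m) ℝ) (n : ℕ) :
    Rn d → Matrix (Fin m) (Fin m) ℝ := fun x => damping n (entrySum (V x)) • V x

lemma mulField_truncPotential (V : Rn d → Matrix (Fin m) (Fin m) ℝ) (n : ℕ) (u : Rn d → Rn m)
    (x : Rn d) :
    mulField (truncPotential V n) u x = damping n (entrySum (V x)) • mulField V u x := by
  simp [mulField, truncPotential]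

lemma norm_mulField_truncPotential_le (V : Rn d → Matrix (Fin m) (Fin m) ℝ) (n : ℕ)
    (u : Rn d → Rn m) (x : Rn d) :
    ‖mulField (truncPotential V n) u x‖ ≤ entrySum (V x) * ‖u x‖ := by
  have hs := entrySum_nonneg (V x)
  rw [mulField_truncPotential, norm_smul, Real.norm_of_nonneg (damping_nonneg n hs)]
  exact (mul_le_of_le_one_left (norm_nonneg _) (damping_le_one n hs)).trans (norm_mulField_le V u x)

lemma IsPotential.aestronglyMeasurable_truncPotential (hV : IsPotential V) (n : ℕ) (i j : Fin m) :
    AEStronglyMeasurable (fun x => truncPotential V n x i j) volume := by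
  have h1 := hV.locallyIntegrable_entrySum.aestronglyMeasurable.aemeasurable
  have h2 : AEMeasurable (fun x => damping n (entrySum (V x))) volume := by
    unfold damping
    exact aemeasurable_const.div (aemeasurable_const.add h1)
  exact (h2.mul (hV.aestronglyMeasurable i j).aemeasurable).aestronglyMeasurable

lemma IsPotential.form_nonneg_truncPotential (hV : IsPotential V) (n : ℕ) :
    ∀ᵐ x, ∀ ξ : Rn m, 0 ≤ ⟪(truncPotential V n x).toEuclideanLin ξ, ξ⟫_ℝ := by
  filter_upwards [hV.form_nonneg] with x hx ξ
  have : (truncPotential V n x).toEuclideanLin ξ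
      = damping n (entrySum (V x)) • (V x).toEuclideanLin ξ := by simp [truncPotential]
  rw [this, inner_smul_left]
  exact mul_nonneg (damping_nonneg n (entrySum_nonneg _)) (hx ξ)

lemma IsPotential.exists_isSolution_truncPotential (hV : IsPotential V) (ha : 0 < a)
    (hf : MemLp f 1) (n : ℕ) : ∃ u, MemLp u 1 ∧ IsSolution (truncPotential V n) a u f := by
  refine exists_isSolution_of_bounded (M := n + 1) (hV.aestronglyMeasurable_truncPotential n) ?_
    (hV.form_nonneg_truncPotential n) (by positivity) (Eventually.of_forall fun x => ?_) ha hf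
  · filter_upwards [hV.symm] with x hx i j
    simp [truncPotential, hx i j]
  · have hs := entrySum_nonneg (V x)
    rw [truncPotential, entrySum_smul, abs_of_nonneg (damping_nonneg n hs)]
    exact damping_mul_le n hs

/-- For `n ≤ k` the factor on the right is at most `entrySum V` and tends to `0` as `n → ∞`. -/
lemma norm_mulField_truncPotential_sub_le (V : Rn d → Matrix (Fin m) (Fin m) ℝ) {n k : ℕ}
    (h : n ≤ k) (u : Rn d → Rn m) (x : Rn d) :
    ‖mulField (truncPotential V k) u x - mulField (truncPotential V n) u x‖
      ≤ ((1 - damping n (entrySum (V x))) * entrySum (V x)) * ‖u x‖ := by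
  have hs := entrySum_nonneg (V x)
  rw [mulField_truncPotential, mulField_truncPotential, ← sub_smul, norm_smul,
    Real.norm_of_nonneg (sub_nonneg.2 (damping_mono h hs)), mul_assoc]
  exact mul_le_mul (sub_le_sub_right (damping_le_one k hs) _) (norm_mulField_le V u x)
    (norm_nonneg _) (sub_nonneg.2 (damping_le_one n hs))

lemma IsPotential.locallyIntegrable_truncError (hV : IsPotential V) (n : ℕ) :
    LocallyIntegrable fun x => (1 - damping n (entrySum (V x))) * entrySum (V x) := by
  have hS := hV.locallyIntegrable_entrySum
  refine hS.mono ?_ (Eventually.of_forall fun x => ?_)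
  · have h1 := hS.aestronglyMeasurable.aemeasurable
    have h2 : AEMeasurable (fun x => damping n (entrySum (V x))) volume := by
      unfold damping
      exact aemeasurable_const.div (aemeasurable_const.add h1)
    exact ((aemeasurable_const.sub h2).mul h1).aestronglyMeasurable
  · have hs := entrySum_nonneg (V x)
    rw [norm_mul, Real.norm_of_nonneg (sub_nonneg.2 (damping_le_one n hs))]
    exact mul_le_of_le_one_left (norm_nonneg _) (by linarith [damping_nonneg n hs])

/-- Stability in `L¹` of the solutions under a change of the truncation level. It comes from
testing Kato's inequality for `u - v` with `cutoff d R`; the three terms are the commutator of the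
cutoff with `Δ`, the change of the potential, and the tail outside of the cutoff. -/
lemma IsPotential.integral_norm_sub_le (hV : IsPotential V) (ha : 0 < a) {B : ℝ}
    {H : Rn d → ℝ} (hH : Integrable H) (hHB : ∀ᵐ x, H x ≤ B) {n k : ℕ} (hnk : n ≤ k)
    {u v : Rn d → Rn m} (hu : IsSolution (truncPotential V n) a u f)
    (hv : IsSolution (truncPotential V k) a v f) (huH : ∀ᵐ x, ‖u x‖ ≤ H x)
    (hvH : ∀ᵐ x, ‖v x‖ ≤ H x) {C : ℝ} {R : ℕ}
    (hC : ∀ x : Rn d, |(Δ (cutoff d R)) x| ≤ C) :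
    a * (∫ x, ‖u x - v x‖) ≤ 2 * C * (∫ x, H x)
      + B * (∫ x, cutoff d R x * ((1 - damping n (entrySum (V x))) * entrySum (V x)))
      + 2 * a * ∫ x, (1 - cutoff d R x) * H x := by
  set g : Rn d → ℝ := fun x => (1 - damping n (entrySum (V x))) * entrySum (V x) with hg
  have hgl : LocallyIntegrable g := hV.locallyIntegrable_truncError n
  have hχ := isTest_cutoff (d := d) R
  set χ := cutoff d R
  have hχ0 : ∀ x, 0 ≤ χ x := cutoff_nonneg R
  have hχ1 : ∀ x, χ x ≤ 1 := cutoff_le_one R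
  have hC0 : 0 ≤ C := (abs_nonneg _).trans (hC 0)
  have hVu : LocallyIntegrable (mulField (truncPotential V k) u) := by
    refine (hV.locallyIntegrable_entrySum.smul B).mono (aestronglyMeasurable_mulField
      (hV.aestronglyMeasurable_truncPotential k) hu.left.aestronglyMeasurable) ?_
    filter_upwards [huH, hHB] with x h1 h2
    refine (norm_mulField_truncPotential_le V k u x).trans (le_trans ?_ (Real.le_norm_self _))
    rw [Pi.smul_apply, smul_eq_mul, mul_comm]
    exact mul_le_mul_of_nonneg_right (h1.trans h2) (entrySum_nonneg _)
  have hw := (hu.change_potential hVu).sub hv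
  set w : Rn d → Rn m := fun x => u x - v x
  have hwH : ∀ᵐ x, ‖w x‖ ≤ 2 * H x := by
    filter_upwards [huH, hvH] with x h1 h2
    have := norm_sub_le (u x) (v x)
    linarith
  have hwi : Integrable w := (hH.const_mul 2).mono' hw.left.aestronglyMeasurable hwH
  have hwn : Integrable fun x => ‖w x‖ := hwi.norm
  obtain ⟨-, hk⟩ := hw.kato hχ hχ0
  rw [integral_resolventOp_mul hχ a (locallyIntegrable_norm hw.left)] at hk
  have hnn : 0 ≤ ∫ x, χ x * (⟪mulField (truncPotential V k) w x, w x⟫_ℝ / ‖w x‖) := by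
    refine integral_nonneg_of_ae ?_
    filter_upwards [hV.form_nonneg_truncPotential k] with x hx
    exact mul_nonneg (hχ0 x) (div_nonneg (hx _) (norm_nonneg _))
  have hrhs : ∫ x, χ x * ‖f x + (mulField (truncPotential V k) u x
      - mulField (truncPotential V n) u x) - f x‖ ≤ B * ∫ x, χ x * g x := by
    rw [← integral_const_mul]
    refine integral_mono_ae (hχ.integrable_mul (locallyIntegrable_norm hw.right))
      ((hχ.integrable_mul hgl).const_mul B) ?_
    filter_upwards [huH, hHB] with x h1 h2
    have hs := entrySum_nonneg (V x)
    have hg0 : 0 ≤ g x := mul_nonneg (sub_nonneg.2 (damping_le_one n hs)) hs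
    have h3 := norm_mulField_truncPotential_sub_le V hnk u x
    have h4 : g x * ‖u x‖ ≤ g x * B := mul_le_mul_of_nonneg_left (h1.trans h2) hg0
    simp only [add_sub_cancel_left]
    calc _ ≤ χ x * (g x * B) := mul_le_mul_of_nonneg_left (h3.trans h4) (hχ0 x)
      _ = _ := by ring
  have hlap : ∫ x, (Δ χ) x * ‖w x‖ ≤ 2 * C * ∫ x, H x := by
    rw [← integral_const_mul]
    refine integral_mono_ae ?_ (hH.const_mul _) ?_
    · exact (locallyIntegrable_norm hw.left).integrable_smul_left_of_hasCompactSupport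
        hχ.continuous_laplacian hχ.compact_laplacian
    · filter_upwards [hwH] with x hx
      calc (Δ χ) x * ‖w x‖ ≤ C * (2 * H x) :=
            mul_le_mul ((le_abs_self _).trans (hC x)) hx (norm_nonneg _) hC0
        _ = _ := by ring
  have i1 : Integrable fun x => χ x * ‖w x‖ := hχ.integrable_mul (locallyIntegrable_norm hw.left)
  have i2 : Integrable fun x => (1 - χ x) * ‖w x‖ := by
    simp only [sub_mul, one_mul]
    exact hwn.sub i1
  have i3 : Integrable fun x => (1 - χ x) * H x := by
    have h1 : Integrable fun x => χ x * H x := hχ.integrable_mul hH.locallyIntegrable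
    simp only [sub_mul, one_mul]
    exact hH.sub h1
  have hsplit : ∫ x, ‖w x‖ = (∫ x, χ x * ‖w x‖) + ∫ x, (1 - χ x) * ‖w x‖ := by
    rw [← integral_add i1 i2]
    congr 1 with x
    ring
  have htail : ∫ x, (1 - χ x) * ‖w x‖ ≤ 2 * ∫ x, (1 - χ x) * H x := by
    rw [← integral_const_mul]
    refine integral_mono_ae i2 (i3.const_mul 2) ?_
    filter_upwards [hwH] with x hx
    calc _ ≤ (1 - χ x) * (2 * H x) := mul_le_mul_of_nonneg_left hx (by linarith [hχ1 x])
      _ = _ := by ring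
  rw [hsplit, mul_add]
  have := mul_le_mul_of_nonneg_left htail ha.le
  linarith

/-- Solvability for bounded integrable right-hand sides, where no comparability of the eigenvalues
is needed: the solutions with the truncated potentials are uniformly bounded, so that
`IsPotential.integral_norm_sub_le` makes them a Cauchy sequence in `L¹`. -/
lemma IsPotential.exists_isSolution_of_bounded_integrable (hV : IsPotential V) (ha : 0 < a)
    (hf : MemLp f 1) (hf' : MemLp f ⊤) : ∃ u, MemLp u 1 ∧ IsSolution V a u f := by
  choose u hu hus using hV.exists_isSolution_truncPotential ha hf
  set H : Rn d → ℝ := resolvent a fun y => ‖f y‖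
  have hH : Integrable H := memLp_one_iff_integrable.1 (memLp_resolvent ha le_rfl hf.norm)
  have huH : ∀ n, ∀ᵐ x, ‖u n x‖ ≤ H x := fun n =>
    (hus n).norm_le_resolvent ha le_rfl (hV.form_nonneg_truncPotential n) (hu n) hf
  have hHtop : MemLp H ⊤ := memLp_resolvent ha le_top hf'.norm
  set B := (eLpNorm H ⊤ volume).toReal
  have hHB : ∀ᵐ x, H x ≤ B := by
    filter_upwards [enorm_ae_le_eLpNormEssSup H volume] with x hx
    rw [← eLpNorm_exponent_top] at hx
    exact (Real.le_norm_self _).trans (by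
      rw [← toReal_enorm]; exact ENNReal.toReal_mono hHtop.2.ne hx)
  obtain ⟨C, hC0, hC⟩ := exists_abs_laplacian_cutoff_le d
  -- The bound of `IsPotential.integral_norm_sub_le` tends to `0` as first `n → ∞` and then `R → ∞`.
  have herr1 : ∀ R, Tendsto (fun n => ∫ x, cutoff d R x *
      ((1 - damping n (entrySum (V x))) * entrySum (V x))) atTop (𝓝 0) := fun R => by
    have hS := (isTest_cutoff (d := d) R).integrable_mul hV.locallyIntegrable_entrySum
    have h1 : Tendsto (fun n => ∫ x, cutoff d R x *
        ((1 - damping n (entrySum (V x))) * entrySum (V x))) atTop (𝓝 (∫ _ : Rn d, (0 : ℝ))) := by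
      refine tendsto_integral_of_dominated_convergence (fun x => cutoff d R x * entrySum (V x))
        (fun n => ((isTest_cutoff R).integrable_mul (hV.locallyIntegrable_truncError n)).1) hS
        (fun n => Eventually.of_forall fun x => ?_) (Eventually.of_forall fun x => ?_)
      · have hs := entrySum_nonneg (V x)
        have h0 := sub_nonneg.2 (damping_le_one n hs)
        rw [Real.norm_of_nonneg (mul_nonneg (cutoff_nonneg R x) (mul_nonneg h0 hs))]
        refine mul_le_mul_of_nonneg_left (mul_le_of_le_one_left hs ?_) (cutoff_nonneg R x)
        linarith [damping_nonneg n hs]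
      · have h2 := ((tendsto_const_nhds (x := (1 : ℝ))).sub
          (tendsto_damping (entrySum_nonneg (V x)))).mul_const (entrySum (V x))
        simpa using h2.const_mul (cutoff d R x)
    simpa using h1
  have herr2 : Tendsto (fun R => ∫ x, (1 - cutoff d R x) * H x) atTop (𝓝 0) := by
    have h1 : Tendsto (fun R => ∫ x, (1 - cutoff d R x) * H x) atTop
        (𝓝 (∫ _ : Rn d, (0 : ℝ))) := by
      refine tendsto_integral_of_dominated_convergence (fun x => ‖H x‖) (fun R => ?_) hH.norm
        (fun R => Eventually.of_forall fun x => ?_) (Eventually.of_forall fun x => ?_)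
      · exact (continuous_const.sub (isTest_cutoff R).continuous).aestronglyMeasurable.mul hH.1
      · rw [norm_mul, Real.norm_of_nonneg (sub_nonneg.2 (cutoff_le_one R x))]
        exact mul_le_of_le_one_left (norm_nonneg _) (by linarith [cutoff_nonneg R x])
      · simpa using ((tendsto_const_nhds (x := (1 : ℝ))).sub (tendsto_cutoff x)).mul_const (H x)
    simpa using h1
  have herr3 : Tendsto (fun R : ℕ => 2 * (C * (((R : ℝ) + 1)⁻¹) ^ 2) * ∫ x, H x) atTop (𝓝 0) := by
    have h1 : Tendsto (fun R : ℕ => ((R : ℝ) + 1)⁻¹) atTop (𝓝 0) := by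
      simpa [one_div] using tendsto_one_div_add_atTop_nhds_zero_nat (𝕜 := ℝ)
    simpa using (((h1.pow 2).const_mul C).const_mul 2).mul_const (∫ x, H x)
  set U : ℕ → LpSpace d m 1 := fun n => (hu n).toLp (u n)
  have hdist : ∀ n k, dist (U n) (U k) = ∫ x, ‖u n x - u k x‖ := fun n k => by
    have h1 : ∫ x, ‖u n x - u k x‖ = (∫⁻ x, ‖u n x - u k x‖ₑ).toReal :=
      integral_norm_eq_lintegral_enorm ((hu n).1.sub (hu k).1)
    rw [Lp.dist_def, eLpNorm_one_eq_lintegral_enorm, h1]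
    congr 1
    refine lintegral_congr_ae ?_
    filter_upwards [(hu n).coeFn_toLp, (hu k).coeFn_toLp] with x h1 h2
    simp only [Pi.sub_apply, U, h1, h2]
  have hcauchy : CauchySeq U := by
    rw [Metric.cauchySeq_iff']
    intro ε hε
    have hε' : 0 < a * ε / 2 := by positivity
    have h1 : Tendsto (fun R : ℕ => 2 * (C * (((R : ℝ) + 1)⁻¹) ^ 2) * (∫ x, H x)
        + 2 * a * ∫ x, (1 - cutoff d R x) * H x) atTop (𝓝 0) := by
      simpa using herr3.add (herr2.const_mul (2 * a))
    obtain ⟨R, hR⟩ := (h1.eventually (gt_mem_nhds hε')).exists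
    have h2 := (herr1 R).const_mul B
    rw [mul_zero] at h2
    obtain ⟨N, hN⟩ := (h2.eventually (gt_mem_nhds hε')).exists
    refine ⟨N, fun n hn => ?_⟩
    have h3 := hV.integral_norm_sub_le ha hH hHB hn (hus N) (hus n) (huH N) (huH n) (hC R)
    rw [dist_comm, hdist]
    refine lt_of_mul_lt_mul_left ?_ ha.le
    linarith
  obtain ⟨v, hv⟩ := cauchySeq_tendsto_of_complete hcauchy
  obtain ⟨ns, hns, hlim⟩ : ∃ ns : ℕ → ℕ, StrictMono ns ∧
      ∀ᵐ x, Tendsto (fun i => U (ns i) x) atTop (𝓝 (v x)) :=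
    (tendstoInMeasure_of_tendsto_Lp hv).exists_seq_tendsto_ae
  have hlim' : ∀ᵐ x, Tendsto (fun i => u (ns i) x) atTop (𝓝 (v x)) := by
    filter_upwards [hlim, ae_all_iff.2 fun n => (hu n).coeFn_toLp] with x h1 h2
    simpa only [U, h2] using h1
  have hvH : ∀ᵐ x, ‖v x‖ ≤ H x := by
    filter_upwards [hlim', ae_all_iff.2 huH] with x h1 h2
    exact le_of_tendsto h1.norm (Eventually.of_forall fun i => h2 _)
  have hvL := Lp.memLp v
  have hfl := hf.locallyIntegrable le_rfl
  have hSB : LocallyIntegrable fun x => B * entrySum (V x) := hV.locallyIntegrable_entrySum.smul B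
  have hVv : LocallyIntegrable (mulField V v) := by
    refine hSB.mono (aestronglyMeasurable_mulField hV.aestronglyMeasurable hvL.1) ?_
    filter_upwards [hvH, hHB] with x h1 h2
    refine (norm_mulField_le V v x).trans (le_trans ?_ (Real.le_norm_self _))
    rw [mul_comm]
    exact mul_le_mul_of_nonneg_right (h1.trans h2) (entrySum_nonneg _)
  refine ⟨v, hvL, hvL.locallyIntegrable le_rfl, hVv, hfl, fun φ hφ => ?_⟩
  have hnsT : Tendsto ns atTop atTop := hns.tendsto_atTop
  have l1 : Tendsto (fun i => ∫ x, (a * φ x - (Δ φ) x) • u (ns i) x) atTop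
      (𝓝 (∫ x, (a * φ x - (Δ φ) x) • v x)) := by
    refine tendsto_integral_of_dominated_convergence (fun x => ‖a * φ x - (Δ φ) x‖ * H x)
      (fun i => (hφ.integrable_resolventOp_smul a (hus _).left).1) ?_ (fun i => ?_) ?_
    · exact hH.locallyIntegrable.integrable_smul_left_of_hasCompactSupport
        (hφ.continuous_resolventOp a).norm (hφ.compact_resolventOp a).norm
    · filter_upwards [huH (ns i)] with x hx
      rw [norm_smul]
      exact mul_le_mul_of_nonneg_left hx (norm_nonneg _)
    · filter_upwards [hlim'] with x hx using hx.const_smul _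
  have l2 : Tendsto (fun i => ∫ x, φ x • mulField (truncPotential V (ns i)) (u (ns i)) x) atTop
      (𝓝 (∫ x, φ x • mulField V v x)) := by
    refine tendsto_integral_of_dominated_convergence (fun x => ‖φ x‖ * (B * entrySum (V x)))
      (fun i => (hφ.integrable_smul (hus _).pot).1) ?_ (fun i => ?_) ?_
    · exact hSB.integrable_smul_left_of_hasCompactSupport hφ.continuous.norm hφ.compact.norm
    · filter_upwards [huH (ns i), hHB] with x h1 h2
      rw [norm_smul]
      refine mul_le_mul_of_nonneg_left ((norm_mulField_truncPotential_le V _ _ x).trans ?_)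
        (norm_nonneg _)
      rw [mul_comm]
      exact mul_le_mul_of_nonneg_right (h1.trans h2) (entrySum_nonneg _)
    · filter_upwards [hlim'] with x hx
      simp only [mulField_truncPotential]
      have h1 := (tendsto_damping (entrySum_nonneg (V x))).comp hnsT
      have h2 : Tendsto (fun i => mulField V (u (ns i)) x) atTop (𝓝 (mulField V v x)) :=
        ((V x).toEuclideanLin.continuous_of_finiteDimensional.tendsto _).comp hx
      simpa using (h1.smul h2).const_smul (φ x)
  refine tendsto_nhds_unique (l1.add l2) ?_
  simp only [fun i => (hus (ns i)).eq φ hφ]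
  exact tendsto_const_nhds

end Truncation

/-! ### Truncation of the right-hand side -/

section LevelTruncation

variable {f : Rn d → Rn m} {p : ℝ≥0∞}

/-- The restriction of `f` to the set where both `|x| ≤ k` and `|f x| ≤ k`. -/
noncomputable def levelTrunc (f : Rn d → Rn m) (k : ℕ) : Rn d → Rn m :=
  {x | ‖x‖ ≤ k ∧ ‖f x‖ ≤ k}.indicator f

lemma measurableSet_levelTrunc (hf : StronglyMeasurable f) (k : ℕ) :
    MeasurableSet {x : Rn d | ‖x‖ ≤ k ∧ ‖f x‖ ≤ k} :=
  (measurableSet_le measurable_norm measurable_const).inter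
    (measurableSet_le hf.norm.measurable measurable_const)

lemma stronglyMeasurable_levelTrunc (hf : StronglyMeasurable f) (k : ℕ) :
    StronglyMeasurable (levelTrunc f k) := hf.indicator (measurableSet_levelTrunc hf k)

lemma norm_levelTrunc_le (f : Rn d → Rn m) (k : ℕ) (x : Rn d) : ‖levelTrunc f k x‖ ≤ ‖f x‖ :=
  norm_indicator_le_norm_self _ _

lemma norm_levelTrunc_le_natCast (f : Rn d → Rn m) (k : ℕ) (x : Rn d) :
    ‖levelTrunc f k x‖ ≤ k := by
  unfold levelTrunc
  by_cases hx : x ∈ {x : Rn d | ‖x‖ ≤ k ∧ ‖f x‖ ≤ k}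
  · rw [Set.indicator_of_mem hx]; exact hx.2
  · rw [Set.indicator_of_notMem hx]; simp

lemma memLp_top_levelTrunc (hf : StronglyMeasurable f) (k : ℕ) : MemLp (levelTrunc f k) ⊤ :=
  memLp_top_of_bound (stronglyMeasurable_levelTrunc hf k).aestronglyMeasurable k
    (Eventually.of_forall fun x => norm_levelTrunc_le_natCast f k x)

lemma memLp_one_levelTrunc (hf : StronglyMeasurable f) (k : ℕ) : MemLp (levelTrunc f k) 1 := by
  rw [memLp_one_iff_integrable]
  have h1 : IntegrableOn (levelTrunc f k) (Metric.closedBall 0 k) :=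
    Measure.integrableOn_of_bounded (M := k)
      (measure_closedBall_lt_top).ne
      (stronglyMeasurable_levelTrunc hf k).aestronglyMeasurable
      (Eventually.of_forall fun x => norm_levelTrunc_le_natCast f k x)
  refine (integrableOn_iff_integrable_of_support_subset fun x hx => ?_).1 h1
  have := Set.mem_of_indicator_ne_zero hx
  simpa using this.1

lemma norm_sub_levelTrunc_le (f : Rn d → Rn m) (k : ℕ) (x : Rn d) :
    ‖f x - levelTrunc f k x‖ ≤ ‖f x‖ := by
  unfold levelTrunc
  by_cases hx : x ∈ {x : Rn d | ‖x‖ ≤ k ∧ ‖f x‖ ≤ k}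
  · rw [Set.indicator_of_mem hx]; simp
  · rw [Set.indicator_of_notMem hx]; simp

lemma norm_levelTrunc_sub_le (f : Rn d → Rn m) {k j : ℕ} (h : k ≤ j) (x : Rn d) :
    ‖levelTrunc f k x - levelTrunc f j x‖ ≤ ‖f x - levelTrunc f k x‖ := by
  have hkj : (k : ℝ) ≤ j := by exact_mod_cast h
  by_cases hx : x ∈ {x : Rn d | ‖x‖ ≤ k ∧ ‖f x‖ ≤ k}
  · have hx' : x ∈ {x : Rn d | ‖x‖ ≤ j ∧ ‖f x‖ ≤ j} := ⟨hx.1.trans hkj, hx.2.trans hkj⟩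
    rw [levelTrunc, levelTrunc, Set.indicator_of_mem hx, Set.indicator_of_mem hx']
  · have h0 : levelTrunc f k x = 0 := Set.indicator_of_notMem hx _
    rw [h0, zero_sub, norm_neg, sub_zero]
    exact norm_levelTrunc_le f j x

lemma tendsto_levelTrunc (f : Rn d → Rn m) (x : Rn d) :
    Tendsto (fun k => levelTrunc f k x) atTop (𝓝 (f x)) := by
  obtain ⟨N, hN⟩ := exists_nat_gt (max ‖x‖ ‖f x‖)
  refine tendsto_const_nhds.congr' ?_
  filter_upwards [eventually_ge_atTop N] with k hk
  have h1 : (N : ℝ) ≤ k := by exact_mod_cast hk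
  have h2 := le_max_left ‖x‖ ‖f x‖
  have h3 := le_max_right ‖x‖ ‖f x‖
  exact (Set.indicator_of_mem (by constructor <;> linarith) f).symm

end LevelTruncation

/-! ### Existence in Lebesgue spaces -/

section Existence

variable {V : Rn d → Matrix (Fin m) (Fin m) ℝ} {a : ℝ} {p : ℝ≥0∞} {f : Rn d → Rn m}

/-- Weighted `L¹` bound of `V w` on balls for a solution `w`, in terms of `w` and the right-hand
side. Here the comparability of the eigenvalues of `V` enters. -/
lemma IsSolution.lintegral_mulField_le {C : ℝ} (hC : 0 ≤ C)
    (hVC : ∀ᵐ x, ∀ ξ : Rn m, ‖(V x).toEuclideanLin ξ‖ * ‖ξ‖ ≤ C * ⟪(V x).toEuclideanLin ξ, ξ⟫_ℝ)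
    {w h : Rn d → Rn m} (hw : IsSolution V a w h) {W G : Rn d → ℝ} (hW : LocallyIntegrable W)
    (hG : LocallyIntegrable G) (hwW : ∀ᵐ x, ‖w x‖ ≤ W x) (hhG : ∀ᵐ x, ‖h x‖ ≤ G x) (R : ℕ) :
    ∫⁻ x in Metric.ball 0 ((R : ℝ) + 1), ‖mulField V w x‖ₑ ≤
      ENNReal.ofReal (C * ((∫ x, cutoff d R x * G x)
        + ∫ x, ‖a * cutoff d R x - (Δ (cutoff d R)) x‖ * W x)) := by
  have hχ := isTest_cutoff (d := d) R
  set χ := cutoff d R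
  have hχ0 : ∀ x, 0 ≤ χ x := cutoff_nonneg R
  obtain ⟨hi, hk⟩ := hw.kato hχ hχ0
  have i1 := hχ.integrable_mul (locallyIntegrable_norm hw.pot)
  have h1 : ∫⁻ x in Metric.ball 0 ((R : ℝ) + 1), ‖mulField V w x‖ₑ
      ≤ ENNReal.ofReal (∫ x, χ x * ‖mulField V w x‖) := by
    rw [ofReal_integral_eq_lintegral_ofReal i1
      (Eventually.of_forall fun x => mul_nonneg (hχ0 x) (norm_nonneg _))]
    refine le_trans (le_of_eq ?_) (setLIntegral_le_lintegral (Metric.ball 0 ((R : ℝ) + 1)) _)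
    refine setLIntegral_congr_fun measurableSet_ball fun x hx => ?_
    have hx1 : χ x = 1 := cutoff_eq_one (mem_ball_zero_iff.1 hx).le
    simp only [hx1, one_mul, ofReal_norm]
  refine h1.trans (ENNReal.ofReal_le_ofReal ?_)
  have h2 : ∫ x, χ x * ‖mulField V w x‖ ≤ C * ∫ x, χ x * (⟪mulField V w x, w x⟫_ℝ / ‖w x‖) := by
    rw [← integral_const_mul]
    refine integral_mono_ae i1 (hi.const_mul C) ?_
    filter_upwards [hVC] with x hx
    have h3 : ‖mulField V w x‖ ≤ C * (⟪mulField V w x, w x⟫_ℝ / ‖w x‖) := by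
      rcases eq_or_ne (w x) 0 with h0 | h0
      · simp [mulField, h0]
      · rw [mul_div_assoc', le_div_iff₀ (norm_pos_iff.2 h0)]
        exact hx _
    calc _ ≤ χ x * (C * (⟪mulField V w x, w x⟫_ℝ / ‖w x‖)) :=
          mul_le_mul_of_nonneg_left h3 (hχ0 x)
      _ = _ := by ring
  refine h2.trans (mul_le_mul_of_nonneg_left ?_ hC)
  have h4 : ∫ x, χ x * ‖h x‖ ≤ ∫ x, χ x * G x :=
    integral_mono_ae (hχ.integrable_mul (locallyIntegrable_norm hw.right)) (hχ.integrable_mul hG)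
      (hhG.mono fun x hx => mul_le_mul_of_nonneg_left hx (hχ0 x))
  have h5 : -∫ x, (a * χ x - (Δ χ) x) * ‖w x‖ ≤ ∫ x, ‖a * χ x - (Δ χ) x‖ * W x := by
    rw [← integral_neg]
    refine integral_mono_ae
      (hχ.integrable_resolventOp_mul a (locallyIntegrable_norm hw.left)).neg
      (hW.integrable_smul_left_of_hasCompactSupport
        (hχ.continuous_resolventOp a).norm (hχ.compact_resolventOp a).norm) ?_
    filter_upwards [hwW] with x hx
    rw [← neg_mul]
    exact mul_le_mul (neg_le_abs _) hx (norm_nonneg _) (norm_nonneg _)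
  linarith

/-- Solvability of `(a - Δ + V) u = f` in `L^p`. The solutions `u k` for the truncations of `f`
converge almost everywhere, dominated by the free resolvent, and
`IsSolution.lintegral_mulField_le` gives the convergence of `V (u k)` in `L¹` on balls. -/
theorem IsPotential.exists_isSolution (hV : IsPotential V) {C : ℝ} (hC : 0 ≤ C)
    (hVC : ∀ᵐ x, ∀ ξ : Rn m, ‖(V x).toEuclideanLin ξ‖ * ‖ξ‖ ≤ C * ⟪(V x).toEuclideanLin ξ, ξ⟫_ℝ)
    (ha : 0 < a) (hp : 1 ≤ p) (hfm : StronglyMeasurable f) (hf : MemLp f p) :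
    ∃ u, MemLp u p ∧ IsSolution V a u f := by
  set F : ℕ → Rn d → Rn m := levelTrunc f
  have hFm : ∀ k, StronglyMeasurable (F k) := stronglyMeasurable_levelTrunc hfm
  have hF1 : ∀ k, MemLp (F k) 1 := memLp_one_levelTrunc hfm
  choose u hu hus using fun k =>
    hV.exists_isSolution_of_bounded_integrable ha (hF1 k) (memLp_top_levelTrunc hfm k)
  set G : ℕ → Rn d → ℝ := fun k x => ‖f x - F k x‖ with hGdef
  have hGm : ∀ k, StronglyMeasurable (G k) := fun k => (hfm.sub (hFm k)).norm
  have hGp : ∀ k, MemLp (G k) p := fun k => hf.of_le (hGm k).aestronglyMeasurable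
    (Eventually.of_forall fun x => by
      rw [hGdef]; simp only [norm_norm]; exact norm_sub_levelTrunc_le f k x)
  have hRG : ∀ k, MemLp (resolvent a (G k)) p := fun k => memLp_resolvent ha hp (hGp k)
  set H : Rn d → ℝ := resolvent a fun y => ‖f y‖
  have hH : MemLp H p := memLp_resolvent ha hp hf.norm
  have hHl := hH.locallyIntegrable hp
  have huH : ∀ k, ∀ᵐ x, ‖u k x‖ ≤ H x := fun k => by
    have h1 : MemLp (fun y => ‖F k y‖) p := hf.of_le (hFm k).norm.aestronglyMeasurable
      (Eventually.of_forall fun x => by simpa using norm_levelTrunc_le f k x)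
    filter_upwards [(hus k).norm_le_resolvent ha le_rfl hV.form_nonneg (hu k) (hF1 k),
      resolvent_mono_ae ha hp h1 hf.norm (Eventually.of_forall fun x => norm_levelTrunc_le f k x)]
      with x h2 h3 using h2.trans h3
  have hRGH : ∀ k, ∀ᵐ x, ‖resolvent a (G k) x‖ ≤ H x := fun k => by
    filter_upwards [resolvent_mono_ae ha hp (hGp k) hf.norm
      (Eventually.of_forall fun x => norm_sub_levelTrunc_le f k x)] with x h2
    have h3 : 0 ≤ resolvent a (G k) x := integral_nonneg fun y => norm_nonneg _
    rwa [Real.norm_of_nonneg h3]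
  have hsub : ∀ k j, IsSolution V a (fun x => u k x - u j x) (fun x => F k x - F j x) :=
    fun k j => (hus k).sub (hus j)
  -- The differences are dominated by the free resolvent of the truncation error.
  have hdiff : ∀ k j, k ≤ j → ∀ᵐ x, ‖u k x - u j x‖ ≤ resolvent a (G k) x := fun k j hkj => by
    have h1 : MemLp (fun y => ‖F k y - F j y‖) p :=
      (hGp k).of_le ((hFm k).sub (hFm j)).norm.aestronglyMeasurable
        (Eventually.of_forall fun x => by simpa [hGdef] using norm_levelTrunc_sub_le f hkj x)
    filter_upwards [(hsub k j).norm_le_resolvent ha le_rfl hV.form_nonneg ((hu k).sub (hu j))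
        ((hF1 k).sub (hF1 j)),
      resolvent_mono_ae ha hp h1 (hGp k)
        (Eventually.of_forall fun x => norm_levelTrunc_sub_le f hkj x)] with x h2 h3
      using h2.trans h3
  have hG0 : ∀ x, Tendsto (fun k => G k x) atTop (𝓝 0) := fun x => by
    have h1 : Tendsto (fun k => ‖f x - levelTrunc f k x‖) atTop (𝓝 ‖f x - f x‖) :=
      ((tendsto_const_nhds (x := f x)).sub (tendsto_levelTrunc f x)).norm
    rw [sub_self, norm_zero] at h1
    exact h1
  have hRG0 : ∀ᵐ x, Tendsto (fun k => resolvent a (G k) x) atTop (𝓝 0) := by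
    have h0 := isFiniteMeasure_resolventMeasure (d := d) ha
    filter_upwards [ae_integrable_translate (ν := resolventMeasure d a) hp hf.norm] with x hx
    have h1 : Tendsto (fun k => ∫ y, G k (x - y) ∂(resolventMeasure d a)) atTop
        (𝓝 (∫ _, (0 : ℝ) ∂(resolventMeasure d a))) := by
      refine tendsto_integral_of_dominated_convergence (fun y => ‖f (x - y)‖) (fun k => ?_) hx
        (fun k => Eventually.of_forall fun y => ?_) (Eventually.of_forall fun y => hG0 _)
      · exact ((hGm k).comp_measurable (by fun_prop)).aestronglyMeasurable
      · rw [hGdef]; simp only [norm_norm]; exact norm_sub_levelTrunc_le f k _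
    rw [integral_zero] at h1
    exact h1
  have hconv : ∀ᵐ x, ∃ l, Tendsto (fun k => u k x) atTop (𝓝 l) := by
    have h1 : ∀ᵐ x, ∀ k j, k ≤ j → ‖u k x - u j x‖ ≤ resolvent a (G k) x := by
      simp only [ae_all_iff]
      exact hdiff
    filter_upwards [h1, hRG0] with x h2 h3
    exact cauchySeq_tendsto_of_complete
      (cauchySeq_of_le_tendsto_0' _ (fun k j hkj => by rw [dist_eq_norm]; exact h2 k j hkj) h3)
  obtain ⟨v, hvm, hv⟩ := measurable_limit_of_tendsto_metrizable_ae
    (fun k => (hu k).1.aemeasurable) hconv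
  have hvm' : AEStronglyMeasurable v volume := hvm.aestronglyMeasurable
  have hvH : ∀ᵐ x, ‖v x‖ ≤ H x := by
    filter_upwards [hv, ae_all_iff.2 huH] with x h1 h2
    exact le_of_tendsto h1.norm (Eventually.of_forall h2)
  have hvp : MemLp v p := hH.of_le hvm' (hvH.mono fun x hx => hx.trans (Real.le_norm_self _))
  have hvl : LocallyIntegrable v := hvp.locallyIntegrable hp
  -- Convergence of `V (u k)` in `L¹` on balls.
  set e : ℕ → ℕ → ℝ := fun R k => C * ((∫ x, cutoff d R x * G k x)
    + ∫ x, ‖a * cutoff d R x - (Δ (cutoff d R)) x‖ * resolvent a (G k) x) with hedef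
  have hVm : AEStronglyMeasurable (mulField V v) volume :=
    aestronglyMeasurable_mulField hV.aestronglyMeasurable hvm'
  have hVlim : ∀ᵐ x, Tendsto (fun k => mulField V (u k) x) atTop (𝓝 (mulField V v x)) := by
    filter_upwards [hv] with x hx
    exact ((V x).toEuclideanLin.continuous_of_finiteDimensional.tendsto _).comp hx
  have hVe : ∀ R k : ℕ, ∫⁻ x in Metric.ball 0 ((R : ℝ) + 1),
      ‖mulField V (u k) x - mulField V v x‖ₑ ≤ ENNReal.ofReal (e R k) := fun R k => by
    have h1 : ∀ j, k ≤ j → ∫⁻ x in Metric.ball 0 ((R : ℝ) + 1),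
        ‖mulField V (u k) x - mulField V (u j) x‖ₑ ≤ ENNReal.ofReal (e R k) := fun j hkj => by
      have h2 := (hsub k j).lintegral_mulField_le hC hVC ((hRG k).locallyIntegrable hp)
        ((hGp k).locallyIntegrable hp) (hdiff k j hkj)
        (Eventually.of_forall fun x => norm_levelTrunc_sub_le f hkj x) R
      rwa [mulField_sub] at h2
    have h3 : ∫⁻ x in Metric.ball 0 ((R : ℝ) + 1), ‖mulField V (u k) x - mulField V v x‖ₑ
        ≤ liminf (fun j => ∫⁻ x in Metric.ball 0 ((R : ℝ) + 1),
          ‖mulField V (u k) x - mulField V (u j) x‖ₑ) atTop := by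
      refine le_trans (le_of_eq (lintegral_congr_ae ?_)) (lintegral_liminf_le' fun j =>
        ((hus k).pot.aestronglyMeasurable.sub (hus j).pot.aestronglyMeasurable).enorm.restrict)
      filter_upwards [ae_restrict_of_ae hVlim] with x hx
      exact ((tendsto_const_nhds.sub hx).enorm.liminf_eq).symm
    refine h3.trans (liminf_le_of_frequently_le' (Eventually.frequently ?_))
    filter_upwards [eventually_ge_atTop k] with j hj using h1 j hj
  have he0 : ∀ R, Tendsto (e R) atTop (𝓝 0) := fun R => by
    have hχ := isTest_cutoff (d := d) R
    have h1 : Tendsto (fun k => ∫ x, cutoff d R x * G k x) atTop (𝓝 (∫ _ : Rn d, (0 : ℝ))) := by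
      refine tendsto_integral_of_dominated_convergence (fun x => ‖cutoff d R x‖ * ‖f x‖)
        (fun k => (hχ.integrable_mul ((hGp k).locallyIntegrable hp)).1) ?_
        (fun k => Eventually.of_forall fun x => ?_) (Eventually.of_forall fun x => ?_)
      · exact (locallyIntegrable_norm
          (hf.locallyIntegrable hp)).integrable_smul_left_of_hasCompactSupport
          hχ.continuous.norm hχ.compact.norm
      · rw [norm_mul]
        refine mul_le_mul_of_nonneg_left ?_ (norm_nonneg _)
        rw [hGdef]; simp only [norm_norm]; exact norm_sub_levelTrunc_le f k x
      · simpa using (hG0 x).const_mul (cutoff d R x)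
    have h2 : Tendsto (fun k => ∫ x, ‖a * cutoff d R x - (Δ (cutoff d R)) x‖ * resolvent a (G k) x)
        atTop (𝓝 (∫ _ : Rn d, (0 : ℝ))) := by
      refine tendsto_integral_of_dominated_convergence
        (fun x => ‖a * cutoff d R x - (Δ (cutoff d R)) x‖ * H x) (fun k => ?_) ?_ (fun k => ?_) ?_
      · exact (((hRG k).locallyIntegrable hp).integrable_smul_left_of_hasCompactSupport
          (hχ.continuous_resolventOp a).norm (hχ.compact_resolventOp a).norm).1
      · exact hHl.integrable_smul_left_of_hasCompactSupport
          (hχ.continuous_resolventOp a).norm (hχ.compact_resolventOp a).norm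
      · filter_upwards [hRGH k] with x hx
        rw [norm_mul, norm_norm]
        exact mul_le_mul_of_nonneg_left hx (norm_nonneg _)
      · filter_upwards [hRG0] with x hx
        simpa using hx.const_mul ‖a * cutoff d R x - (Δ (cutoff d R)) x‖
    have h3 := (h1.add h2).const_mul C
    rw [integral_zero, add_zero, mul_zero] at h3
    exact h3
  have hVL1 : ∀ R : ℕ, Tendsto (fun k => ∫⁻ x in Metric.ball 0 ((R : ℝ) + 1),
      ‖mulField V (u k) x - mulField V v x‖ₑ) atTop (𝓝 0) := fun R => by
    have h1 := ENNReal.tendsto_ofReal (he0 R)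
    rw [ENNReal.ofReal_zero] at h1
    exact tendsto_of_tendsto_of_tendsto_of_le_of_le tendsto_const_nhds h1 (fun _ => zero_le)
      (hVe R)
  have hVv : LocallyIntegrable (mulField V v) := by
    rw [locallyIntegrable_iff]
    intro K hK
    obtain ⟨r, hr⟩ := hK.isBounded.subset_ball 0
    obtain ⟨R, hR⟩ := exists_nat_gt r
    have h1 : IntegrableOn (fun x => mulField V (u 0) x - mulField V v x)
        (Metric.ball 0 ((R : ℝ) + 1)) :=
      ⟨((hus 0).pot.aestronglyMeasurable.sub hVm).restrict,
        (hVe R 0).trans_lt ENNReal.ofReal_lt_top⟩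
    have h2 : IntegrableOn (mulField V (u 0)) (Metric.ball 0 ((R : ℝ) + 1)) :=
      ((hus 0).pot.integrableOn_isCompact (isCompact_closedBall 0 _)).mono_set
        Metric.ball_subset_closedBall
    have h3 : IntegrableOn (mulField V v) (Metric.ball 0 ((R : ℝ) + 1)) := by
      refine (h2.sub h1).congr (Eventually.of_forall fun x => ?_)
      simp
    exact h3.mono_set (hr.trans (Metric.ball_subset_ball (by linarith)))
  refine ⟨v, hvp, hvl, hVv, hf.locallyIntegrable hp, fun φ hφ => ?_⟩
  have l1 : Tendsto (fun k => ∫ x, (a * φ x - (Δ φ) x) • u k x) atTop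
      (𝓝 (∫ x, (a * φ x - (Δ φ) x) • v x)) := by
    refine tendsto_integral_of_dominated_convergence (fun x => ‖a * φ x - (Δ φ) x‖ * H x)
      (fun k => (hφ.integrable_resolventOp_smul a (hus _).left).1) ?_ (fun k => ?_) ?_
    · exact hHl.integrable_smul_left_of_hasCompactSupport
        (hφ.continuous_resolventOp a).norm (hφ.compact_resolventOp a).norm
    · filter_upwards [huH k] with x hx
      rw [norm_smul]
      exact mul_le_mul_of_nonneg_left hx (norm_nonneg _)
    · filter_upwards [hv] with x hx using hx.const_smul _
  have l2 : Tendsto (fun k => ∫ x, φ x • mulField V (u k) x) atTop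
      (𝓝 (∫ x, φ x • mulField V v x)) := by
    obtain ⟨r, hr⟩ := exists_forall_eq_zero_of_notMem_ball hφ.compact
    obtain ⟨R, hR⟩ := exists_nat_gt r
    obtain ⟨B, hB⟩ := hφ.continuous.bounded_above_of_compact_support hφ.compact
    refine tendsto_integral_of_le_L1_ball (C := B) (hVL1 R)
      (fun k => hφ.integrable_smul (hus k).pot) (hφ.integrable_smul hVv) (fun k x => ?_)
      fun k x hx => by rw [hr _ (by linarith) x hx]; simp
    rw [← smul_sub, norm_smul]
    exact mul_le_mul_of_nonneg_right (hB x) (norm_nonneg _)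
  have l3 : Tendsto (fun k => ∫ x, φ x • F k x) atTop (𝓝 (∫ x, φ x • f x)) := by
    refine tendsto_integral_of_dominated_convergence (fun x => ‖φ x • f x‖)
      (fun k => (hφ.integrable_smul (hus k).right).1)
      (hφ.integrable_smul (hf.locallyIntegrable hp)).norm
      (fun k => Eventually.of_forall fun x => ?_)
      (Eventually.of_forall fun x => (tendsto_levelTrunc f x).const_smul (φ x))
    rw [norm_smul, norm_smul]
    exact mul_le_mul_of_nonneg_left (norm_levelTrunc_le f k x) (norm_nonneg _)
  refine tendsto_nhds_unique (l1.add l2) ?_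
  simpa only [fun k => (hus k).eq φ hφ] using l3

end Existence

end KatoSchrodinger

theorem mainTheorem4 {d m : ℕ}
    (V : KatoSchrodinger.Rn d → Matrix (Fin m) (Fin m) ℝ)
    (hV : KatoSchrodinger.IsPotential V)
    (hV' : KatoSchrodinger.HasComparableEigenvalues V)
    (p : ℝ≥0∞) [Fact (1 ≤ p)] :
    KatoSchrodinger.IsMDissipative (-(KatoSchrodinger.katoOp V p)) := by
  refine ⟨KatoSchrodinger.isDissipative_neg_katoOp hV.form_nonneg, fun a ha f => ?_⟩
  obtain ⟨C, hC, hcomp⟩ := hV'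
  have hVC : ∀ᵐ x, ∀ ξ : KatoSchrodinger.Rn m,
      ‖(V x).toEuclideanLin ξ‖ * ‖ξ‖ ≤ C * ⟪(V x).toEuclideanLin ξ, ξ⟫_ℝ := by
    filter_upwards [hV.symm, hV.form_nonneg, hcomp] with x h1 h2 h3 ξ
    exact KatoSchrodinger.norm_mul_norm_le_of_comparable h1 h2 (by linarith) h3.2 ξ
  obtain ⟨u, hu, hs⟩ := hV.exists_isSolution (by linarith) hVC ha (Fact.out : 1 ≤ p)
    (Lp.stronglyMeasurable f) (Lp.memLp f)
  have hpair : KatoSchrodinger.IsKatoPair V p (hu.toLp u) (f - a • hu.toLp u) :=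
    KatoSchrodinger.isKatoPair_of_isSolution
      (hs.congr hu.coeFn_toLp.symm (Filter.EventuallyEq.refl _ _))
  obtain ⟨y, hy1, hy2⟩ := (LinearPMap.mem_graph_iff _).1
    ((KatoSchrodinger.mem_graph_katoOp V p _ _).2 hpair)
  refine ⟨y, ?_⟩
  rw [LinearPMap.neg_apply, sub_neg_eq_add, hy2]
  change a • (y : KatoSchrodinger.LpSpace d m p) + _ = f
  rw [hy1]
  exact add_sub_cancel _ _
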